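/- **Setting.** Let $n \geq 0$. An $n$-globular set $X$ consists of sets $X_0,\dots,X_n$ of $k$-cells and source and target maps $s,t : X_{k+1} \to X_k$ with $ss = st$ and $ts = tt$. Two $k$-cells are *parallel* if $k = 0$, or if they have the same source and the same target. Let $\mathbf 1$ be the terminal $n$-globular set and $!$ the unique map to it. Let $(-)^*$, with unit $\eta$ and multiplication $\mu$, be the monad on $n$-globular sets that is induced by the adjunction with strict $n$-categories; so $X^*$ is the $n$-globular set underlying the free strict $n$-category on $X$. The source and the target of a $(k+1)$-cell $\tau$ of $\mathbf 1^*$ coincide; their common value is denoted by $\partial\tau$. An *$n$-globular collection* is an $n$-globular set $G$ with a map $g : G \to \mathbf 1^*$; its morphisms are the maps over $\mathbf 1^*$. The composite $G \circ H$ of collections $g : G \to \mathbf 1^*$, $h : H \to \mathbf 1^*$ is the pullback of $!^* : G^* \to \mathbf 1^*$ along $h$, with the map $G \circ H \to G^* \xrightarrow{g^*} \mathbf 1^{**} \xrightarrow{\mu} \mathbf 1^*$ to $\mathbf 1^*$. This gives a monoidal structure on collections, with unit $\eta : \mathbf 1 \to \mathbf 1^*$; an *$n$-globular operad* is a monoid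 in this monoidal category, and a morphism of operads is a morphism of monoids. The identity $k$-cell $\mathrm{id}_k$ of an operad is the image of the $k$-cell of $\mathbf 1$ under the unit of the monoid; an *operadic composite* is a value of the multiplication $G \circ G \to G$. For $0 < k \leq n$, an *admissible triple* of dimension $k$ in a collection $g : G \to \mathbf 1^*$ is a triple $(x,x',\tau)$, where $x,x'$ are parallel $(k-1)$-cells of $G$ and $\tau$ is a $k$-cell of $\mathbf 1^*$ with $g(x) = g(x') = \partial\tau$. A *contraction* on $G$ assigns to every admissible triple $(x,x',\tau)$, of every dimension $0<k\le n$, a $k$-cell $x \to x'$ of $G$ whose image under $g$ is $\tau$. An $n$-globular operad is *contractible* if a contraction on it exists and any two parallel $n$-cells with the same image in $\mathbf 1^*$ are equal. Let $\mathbf{C\text{-}GOp}_n$ be the category of contractible $n$-globular operads with a specified contraction, and of those morphisms of operads that preserve the contractions. **The operad $I_n$.** Let $i : I_n \to \mathbf 1^*$ be the contractible $n$-globular operad whose cells are the operadic composites of identity cells $\mathrm{id}_k$ and of one generating $k$-cell $\chi : x \to x'$ with $i(\chi) = \tau$ for each admissible triple $(x,x',\tau)$ in $I_n$ of dimension $k$,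 subject to no relations in dimensions below $n$ other than those that hold in every $n$-globular operad, and subject in dimension $n$ to the further relations that parallel $n$-cells with the same image in $\mathbf 1^*$ are equal. Thus $I_n$ has a single $0$-cell, $\mathrm{id}_0$; for $0<k<n$ its $k$-cells are the operadic composites of the identity cells and the generating cells, with no relations; and for $n>0$ it has exactly one $n$-cell for every admissible triple of dimension $n$. The *canonical contraction* on $I_n$ assigns the generating cell $\chi$ to the triple $(x,x',\tau)$. **Statement.** For every $n \geq 0$, the operad $I_n$ with its canonical contraction is an initial object of $\mathbf{C\text{-}GOp}_n$: for every contractible $n$-globular operad $G$ with a specified contraction there is exactly one contraction preserving morphism of $n$-globular operads $I_n \to G$. -/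

import Mathlib

universe u

namespace Glob

variable {n : ℕ}

/-- An `n`-globular set `G_n ⇉ ⋯ ⇉ G_1 ⇉ G_0`: a set of `k`-cells for every `k ≤ n`, with source
and target maps satisfying `ss = st` and `ts = tt`. -/
structure GSet (n : ℕ) where
  cell : (k : ℕ) → k ≤ n → Type u
  src : ∀ {k : ℕ} {h : k + 1 ≤ n}, cell (k + 1) h → cell k (Nat.le_of_succ_le h)
  tgt : ∀ {k : ℕ} {h : k + 1 ≤ n}, cell (k + 1) h → cell k (Nat.le_of_succ_le h)
  src_src : ∀ {k : ℕ} {h : k + 1 + 1 ≤ n} (x : cell (k + 1 + 1) h), src (src x) = src (tgt x)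
  tgt_tgt : ∀ {k : ℕ} {h : k + 1 + 1 ≤ n} (x : cell (k + 1 + 1) h), tgt (src x) = tgt (tgt x)

/-- Morphisms of `n`-globular sets. -/
structure GMap (X Y : GSet.{u} n) where
  app : ∀ {k : ℕ} {h : k ≤ n}, X.cell k h → Y.cell k h
  map_src : ∀ {k : ℕ} {h : k + 1 ≤ n} (x : X.cell (k + 1) h), app (X.src x) = Y.src (app x)
  map_tgt : ∀ {k : ℕ} {h : k + 1 ≤ n} (x : X.cell (k + 1) h), app (X.tgt x) = Y.tgt (app x)

theorem GMap.ext {X Y : GSet.{u} n} {f g : GMap X Y}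
    (H : ∀ (k : ℕ) (h : k ≤ n) (x : X.cell k h), f.app x = g.app x) : f = g := by
  cases f; cases g
  congr
  funext k h x
  exact H k h x

/-- The identity morphism. -/
def GMap.id (X : GSet.{u} n) : GMap X X where
  app x := x
  map_src _ := rfl
  map_tgt _ := rfl

/-- Composition of morphisms, `g` after `f`. -/
def GMap.comp {X Y Z : GSet.{u} n} (g : GMap Y Z) (f : GMap X Y) : GMap X Z where
  app x := g.app (f.app x)
  map_src x := by rw [f.map_src, g.map_src]
  map_tgt x := by rw [f.map_tgt, g.map_tgt]

/-- The terminal `n`-globular set `1`, with one cell in each dimension. -/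
def one (n : ℕ) : GSet.{u} n where
  cell _ _ := PUnit
  src _ := PUnit.unit
  tgt _ := PUnit.unit
  src_src _ := rfl
  tgt_tgt _ := rfl

/-- The unique morphism `! : X ⟶ 1`. -/
def bang (X : GSet.{u} n) : GMap X (one n) where
  app _ := PUnit.unit
  map_src _ := rfl
  map_tgt _ := rfl

/-- Two `k`-cells are parallel if `k = 0` or if they have the same source and the same target. -/
def GSet.Parallel (X : GSet.{u} n) : {k : ℕ} → {h : k ≤ n} → X.cell k h → X.cell k h → Prop
  | 0, _, _, _ => True
  | _ + 1, _, x, y => X.src x = X.src y ∧ X.tgt x = X.tgt y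

/-- `X.Meets c x y`: the `k`-cells `x`, `y` satisfy `c ≤ k`, and the `c`-fold target of `x` (a cell
of dimension `k - c`) equals the `c`-fold source of `y`. -/
def GSet.Meets (X : GSet.{u} n) :
    (c : ℕ) → {k : ℕ} → {h : k ≤ n} → X.cell k h → X.cell k h → Prop
  | 0, _, _, x, y => x = y
  | _ + 1, 0, _, _, _ => False
  | c + 1, _ + 1, _, x, y => GSet.Meets X c (X.tgt x) (X.src y)

/-- The operations of a strict `n`-category: identities, and for each `c` the composition of
`k`-cells along boundaries of dimension `k - (c + 1)` (in diagrammatic order). -/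
structure NCatData (n : ℕ) extends GSet.{u} n where
  idn : ∀ {k : ℕ} {h : k + 1 ≤ n}, cell k (Nat.le_of_succ_le h) → cell (k + 1) h
  comp : ∀ (c : ℕ) {k : ℕ} {h : k ≤ n} (x y : cell k h), toGSet.Meets (c + 1) x y → cell k h

/-- The `c`-fold identity on the `c`-fold source of a cell. -/
def NCatData.srcUnit (C : NCatData.{u} n) :
    (c : ℕ) → {k : ℕ} → {h : k ≤ n} → C.cell k h → C.cell k h
  | 0, _, _, x => x
  | _ + 1, 0, _, x => x
  | c + 1, _ + 1, _, x => C.idn (NCatData.srcUnit C c (C.src x))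

/-- The `c`-fold identity on the `c`-fold target of a cell. -/
def NCatData.tgtUnit (C : NCatData.{u} n) :
    (c : ℕ) → {k : ℕ} → {h : k ≤ n} → C.cell k h → C.cell k h
  | 0, _, _, x => x
  | _ + 1, 0, _, x => x
  | c + 1, _ + 1, _, x => C.idn (NCatData.tgtUnit C c (C.tgt x))

/-- Strict `n`-categories. The composability conditions on composites and identities that occur as
hypotheses of the axioms all follow from those on the cells involved. -/
structure NCat (n : ℕ) extends NCatData.{u} n where
  src_idn : ∀ {k : ℕ} {h : k + 1 ≤ n} (x : cell k (Nat.le_of_succ_le h)),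
    src (idn (h := h) x) = x
  tgt_idn : ∀ {k : ℕ} {h : k + 1 ≤ n} (x : cell k (Nat.le_of_succ_le h)),
    tgt (idn (h := h) x) = x
  src_comp_zero : ∀ {k : ℕ} {h : k + 1 ≤ n} (x y : cell (k + 1) h) (p : toGSet.Meets 1 x y),
    src (comp 0 x y p) = src x
  tgt_comp_zero : ∀ {k : ℕ} {h : k + 1 ≤ n} (x y : cell (k + 1) h) (p : toGSet.Meets 1 x y),
    tgt (comp 0 x y p) = tgt y
  src_comp_succ : ∀ (c : ℕ) {k : ℕ} {h : k + 1 ≤ n} (x y : cell (k + 1) h)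
    (p : toGSet.Meets (c + 2) x y) (q : toGSet.Meets (c + 1) (src x) (src y)),
    src (comp (c + 1) x y p) = comp c (src x) (src y) q
  tgt_comp_succ : ∀ (c : ℕ) {k : ℕ} {h : k + 1 ≤ n} (x y : cell (k + 1) h)
    (p : toGSet.Meets (c + 2) x y) (q : toGSet.Meets (c + 1) (tgt x) (tgt y)),
    tgt (comp (c + 1) x y p) = comp c (tgt x) (tgt y) q
  assoc : ∀ (c : ℕ) {k : ℕ} {h : k ≤ n} (x y z : cell k h) (p : toGSet.Meets (c + 1) x y)
    (q : toGSet.Meets (c + 1) y z) (p' : toGSet.Meets (c + 1) (comp c x y p) z)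
    (q' : toGSet.Meets (c + 1) x (comp c y z q)),
    comp c (comp c x y p) z p' = comp c x (comp c y z q) q'
  unit_comp : ∀ (c : ℕ) {k : ℕ} {h : k ≤ n} (x : cell k h)
    (p : toGSet.Meets (c + 1) (toNCatData.srcUnit (c + 1) x) x),
    comp c (toNCatData.srcUnit (c + 1) x) x p = x
  comp_unit : ∀ (c : ℕ) {k : ℕ} {h : k ≤ n} (x : cell k h)
    (p : toGSet.Meets (c + 1) x (toNCatData.tgtUnit (c + 1) x)),
    comp c x (toNCatData.tgtUnit (c + 1) x) p = x
  interchange : ∀ (c d : ℕ), c < d → ∀ {k : ℕ} {h : k ≤ n} (x y x' y' : cell k h)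
    (p : toGSet.Meets (c + 1) x y) (p' : toGSet.Meets (c + 1) x' y')
    (q : toGSet.Meets (d + 1) x x') (q' : toGSet.Meets (d + 1) y y')
    (r : toGSet.Meets (d + 1) (comp c x y p) (comp c x' y' p'))
    (r' : toGSet.Meets (c + 1) (comp d x x' q) (comp d y y' q')),
    comp d (comp c x y p) (comp c x' y' p') r = comp c (comp d x x' q) (comp d y y' q') r'
  idn_comp : ∀ (c : ℕ) {k : ℕ} {h : k + 1 ≤ n} (x y : cell k (Nat.le_of_succ_le h))
    (p : toGSet.Meets (c + 1) x y) (q : toGSet.Meets (c + 2) (idn (h := h) x) (idn (h := h) y)),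
    idn (h := h) (comp c x y p) = comp (c + 1) (idn x) (idn y) q

theorem GMap.map_meets {X Y : GSet.{u} n} (f : GMap X Y) : ∀ (c : ℕ) {k : ℕ} {h : k ≤ n}
    {x y : X.cell k h}, X.Meets c x y → Y.Meets c (f.app x) (f.app y)
  | 0, _, _, _, _, p => congrArg f.app p
  | _ + 1, 0, _, _, _, p => p.elim
  | c + 1, _ + 1, _, x, y, p => by
      have := GMap.map_meets f c (x := X.tgt x) (y := X.src y) p
      rw [f.map_tgt, f.map_src] at this
      exact this

theorem GSet.meets_src (X : GSet.{u} n) {c k : ℕ} {h : k + 1 ≤ n} {x y : X.cell (k + 1) h}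
    (p : X.Meets (c + 2) x y) : X.Meets (c + 1) (X.src x) (X.src y) := by
  cases k with
  | zero => exact p
  | succ k =>
    have p' : X.Meets c (X.tgt (X.tgt x)) (X.src (X.src y)) := p
    rw [← X.tgt_tgt] at p'
    exact p'

theorem GSet.meets_tgt (X : GSet.{u} n) {c k : ℕ} {h : k + 1 ≤ n} {x y : X.cell (k + 1) h}
    (p : X.Meets (c + 2) x y) : X.Meets (c + 1) (X.tgt x) (X.tgt y) := by
  cases k with
  | zero => exact p
  | succ k =>
    have p' : X.Meets c (X.tgt (X.tgt x)) (X.src (X.src y)) := p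
    rw [X.src_src] at p'
    exact p'

/-! ### The free strict `n`-category monad -/

/-- Formal composites of the cells of a family `X`. -/
inductive PExpr (X : (k : ℕ) → k ≤ n → Type u) : (k : ℕ) → k ≤ n → Type u
  | gen {k : ℕ} {h : k ≤ n} (x : X k h) : PExpr X k h
  | idn {k : ℕ} {h : k + 1 ≤ n} (a : PExpr X k (Nat.le_of_succ_le h)) : PExpr X (k + 1) h
  | comp (c : ℕ) {k : ℕ} {h : k ≤ n} (a b : PExpr X k h) : PExpr X k h

/-- Replace every cell in a formal composite by a formal composite. -/
def PExpr.bind {X Y : (k : ℕ) → k ≤ n → Type u}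
    (f : ∀ {k : ℕ} {h : k ≤ n}, X k h → PExpr Y k h) :
    {k : ℕ} → {h : k ≤ n} → PExpr X k h → PExpr Y k h
  | _, _, .gen x => f x
  | _, _, .idn a => .idn (PExpr.bind f a)
  | _, _, .comp c a b => .comp c (PExpr.bind f a) (PExpr.bind f b)

/-- Relabel the cells in a formal composite. -/
def PExpr.map {X Y : (k : ℕ) → k ≤ n → Type u}
    (f : ∀ {k : ℕ} {h : k ≤ n}, X k h → Y k h) {k : ℕ} {h : k ≤ n} (a : PExpr X k h) :
    PExpr Y k h :=
  a.bind fun x => .gen (f x)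

/-- The source of a formal composite of cells of a globular set. -/
def PExpr.src (X : GSet.{u} n) :
    {k : ℕ} → {h : k + 1 ≤ n} → PExpr X.cell (k + 1) h → PExpr X.cell k (Nat.le_of_succ_le h)
  | _, _, .gen x => .gen (X.src x)
  | _, _, .idn a => a
  | _, _, .comp 0 a _ => PExpr.src X a
  | _, _, .comp (c + 1) a b => .comp c (PExpr.src X a) (PExpr.src X b)

/-- The target of a formal composite of cells of a globular set. -/
def PExpr.tgt (X : GSet.{u} n) :
    {k : ℕ} → {h : k + 1 ≤ n} → PExpr X.cell (k + 1) h → PExpr X.cell k (Nat.le_of_succ_le h)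
  | _, _, .gen x => .gen (X.tgt x)
  | _, _, .idn a => a
  | _, _, .comp 0 _ b => PExpr.tgt X b
  | _, _, .comp (c + 1) a b => .comp c (PExpr.tgt X a) (PExpr.tgt X b)

open Classical in
/-- The value of a formal composite in a strict `n`-category; it is `none` if cells that do not
meet are composed. -/
noncomputable def PExpr.eval {X : (k : ℕ) → k ≤ n → Type u} (C : NCat.{u} n)
    (f : ∀ {k : ℕ} {h : k ≤ n}, X k h → C.cell k h) :
    {k : ℕ} → {h : k ≤ n} → PExpr X k h → Option (C.cell k h)
  | _, _, .gen x => some (f x)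
  | _, _, .idn a => (PExpr.eval C f a).map fun v => C.idn v
  | _, _, .comp c a b => (PExpr.eval C f a).bind fun v => (PExpr.eval C f b).bind fun w =>
      if p : C.Meets (c + 1) v w then some (C.comp c v w p) else none

/-- A formal composite is a pasting diagram if it has a value in every strict `n`-category that
`X` is mapped to. -/
def PExpr.IsPasting (X : GSet.{u} n) {k : ℕ} {h : k ≤ n} (a : PExpr X.cell k h) : Prop :=
  ∀ (C : NCat.{u} n) (f : GMap X C.toGSet), ∃ v, a.eval C f.app = some v

/-- Two pasting expressions are identified if they are equal in every strict `n`-category. -/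
def pastingSetoid (X : GSet.{u} n) (k : ℕ) (h : k ≤ n) :
    Setoid {a : PExpr X.cell k h // a.IsPasting X} where
  r a b := ∀ (C : NCat.{u} n) (f : GMap X C.toGSet), a.1.eval C f.app = b.1.eval C f.app
  iseqv := ⟨fun _ _ _ => rfl, fun H C f => (H C f).symm, fun H H' C f => (H C f).trans (H' C f)⟩

/-- The `k`-cells of the free strict `n`-category on `X`: `k`-pasting diagrams in `X`. -/
def FreeCell (X : GSet.{u} n) (k : ℕ) (h : k ≤ n) : Type u := Quotient (pastingSetoid X k h)

/-- The pasting diagram denoted by an expression. -/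
def PExpr.mk (X : GSet.{u} n) {k : ℕ} {h : k ≤ n} (a : PExpr X.cell k h) (H : a.IsPasting X) :
    FreeCell X k h := Quotient.mk (pastingSetoid X k h) ⟨a, H⟩

/-- `a.Denotes X p`: the expression `a` denotes the pasting diagram `p`. -/
def PExpr.Denotes (X : GSet.{u} n) {k : ℕ} {h : k ≤ n} (a : PExpr X.cell k h)
    (p : FreeCell X k h) : Prop := ∃ H : a.IsPasting X, PExpr.mk X a H = p

theorem exists_denotes {X : GSet.{u} n} {k : ℕ} {h : k ≤ n} (p : FreeCell X k h) :
    ∃ a : PExpr X.cell k h, a.Denotes X p := by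
  induction p using Quotient.inductionOn with
  | h a => exact ⟨a.1, a.2, rfl⟩

/-- The value of a pasting diagram in a strict `n`-category. -/
noncomputable def evalFree {X : GSet.{u} n} (C : NCat.{u} n) (f : GMap X C.toGSet) {k : ℕ}
    {h : k ≤ n} (p : FreeCell X k h) : C.cell k h :=
  Quotient.lift (fun a => (a.2 C f).choose)
    (fun a b H => Option.some.inj
      ((a.2 C f).choose_spec.symm.trans ((H C f).trans (b.2 C f).choose_spec))) p

theorem eval_of_denotes {X : GSet.{u} n} (C : NCat.{u} n) (f : GMap X C.toGSet) {k : ℕ}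
    {h : k ≤ n} {a : PExpr X.cell k h} {p : FreeCell X k h} (H : a.Denotes X p) :
    a.eval C f.app = some (evalFree C f p) := by
  obtain ⟨Ha, rfl⟩ := H
  exact (Ha C f).choose_spec

theorem evalFree_ext {X : GSet.{u} n} {k : ℕ} {h : k ≤ n} {p q : FreeCell X k h}
    (H : ∀ (C : NCat.{u} n) (f : GMap X C.toGSet), evalFree C f p = evalFree C f q) : p = q := by
  obtain ⟨a, Ha⟩ := exists_denotes p
  obtain ⟨b, Hb⟩ := exists_denotes q
  obtain ⟨Wa, ea⟩ := id Ha
  obtain ⟨Wb, eb⟩ := id Hb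
  rw [← ea, ← eb]
  refine Quotient.sound fun C f => ?_
  exact (eval_of_denotes C f Ha).trans ((congrArg some (H C f)).trans (eval_of_denotes C f Hb).symm)

theorem evalFree_eq {X : GSet.{u} n} (C : NCat.{u} n) (f : GMap X C.toGSet) {k : ℕ}
    {h : k ≤ n} {a : PExpr X.cell k h} {p : FreeCell X k h} (H : a.Denotes X p) {v : C.cell k h}
    (e : a.eval C f.app = some v) : evalFree C f p = v :=
  Option.some.inj ((eval_of_denotes C f H).symm.trans e)

theorem PExpr.eval_comp {X : (k : ℕ) → k ≤ n → Type u} (C : NCat.{u} n)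
    (f : ∀ {k : ℕ} {h : k ≤ n}, X k h → C.cell k h) {c k : ℕ} {h : k ≤ n} {a b : PExpr X k h}
    {u : C.cell k h} :
    (PExpr.comp c a b).eval C f = some u ↔ ∃ (v w : C.cell k h) (p : C.Meets (c + 1) v w),
      a.eval C f = some v ∧ b.eval C f = some w ∧ u = C.comp c v w p := by
  simp only [PExpr.eval, Option.bind_eq_some_iff]
  constructor
  · rintro ⟨v, hv, w, hw, e⟩
    by_cases p : C.Meets (c + 1) v w
    · rw [dif_pos p] at e
      exact ⟨v, w, p, hv, hw, (Option.some.inj e).symm⟩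
    · rw [dif_neg p] at e
      cases e
  · rintro ⟨v, w, p, hv, hw, rfl⟩
    exact ⟨v, hv, w, hw, dif_pos p⟩

theorem PExpr.eval_idn {X : (k : ℕ) → k ≤ n → Type u} (C : NCat.{u} n)
    (f : ∀ {k : ℕ} {h : k ≤ n}, X k h → C.cell k h) {k : ℕ} {h : k + 1 ≤ n}
    {a : PExpr X k (Nat.le_of_succ_le h)} {u : C.cell (k + 1) h} :
    (PExpr.idn a).eval C f = some u ↔ ∃ v, a.eval C f = some v ∧ u = C.idn v := by
  simp only [PExpr.eval, Option.map_eq_some_iff]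
  exact ⟨fun ⟨v, a, b⟩ => ⟨v, a, b.symm⟩, fun ⟨v, a, b⟩ => ⟨v, a, b.symm⟩⟩

theorem PExpr.eval_src {X : GSet.{u} n} (C : NCat.{u} n) (f : GMap X C.toGSet) :
    ∀ {k : ℕ} {h : k + 1 ≤ n} (a : PExpr X.cell (k + 1) h) {v : C.cell (k + 1) h},
      a.eval C f.app = some v → (a.src X).eval C f.app = some (C.src v)
  | _, _, .gen x, v, e => by
      cases Option.some.inj e
      rw [PExpr.src]
      exact congrArg some (f.map_src x)
  | _, _, .idn a, v, e => by
      obtain ⟨w, hw, rfl⟩ := (PExpr.eval_idn C f.app).1 e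
      rw [C.src_idn]
      rw [PExpr.src]
      exact hw
  | _, _, .comp 0 a b, u, e => by
      obtain ⟨v, w, p, hv, hw, rfl⟩ := (PExpr.eval_comp C f.app).1 e
      rw [C.src_comp_zero]
      rw [PExpr.src]
      exact PExpr.eval_src C f a hv
  | _, _, .comp (c + 1) a b, u, e => by
      obtain ⟨v, w, p, hv, hw, rfl⟩ := (PExpr.eval_comp C f.app).1 e
      rw [C.src_comp_succ c v w p (C.meets_src p)]
      rw [PExpr.src]
      exact (PExpr.eval_comp C f.app).2
        ⟨_, _, _, PExpr.eval_src C f a hv, PExpr.eval_src C f b hw, rfl⟩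

theorem PExpr.eval_tgt {X : GSet.{u} n} (C : NCat.{u} n) (f : GMap X C.toGSet) :
    ∀ {k : ℕ} {h : k + 1 ≤ n} (a : PExpr X.cell (k + 1) h) {v : C.cell (k + 1) h},
      a.eval C f.app = some v → (a.tgt X).eval C f.app = some (C.tgt v)
  | _, _, .gen x, v, e => by
      cases Option.some.inj e
      rw [PExpr.tgt]
      exact congrArg some (f.map_tgt x)
  | _, _, .idn a, v, e => by
      obtain ⟨w, hw, rfl⟩ := (PExpr.eval_idn C f.app).1 e
      rw [C.tgt_idn]
      rw [PExpr.tgt]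
      exact hw
  | _, _, .comp 0 a b, u, e => by
      obtain ⟨v, w, p, hv, hw, rfl⟩ := (PExpr.eval_comp C f.app).1 e
      rw [C.tgt_comp_zero]
      rw [PExpr.tgt]
      exact PExpr.eval_tgt C f b hw
  | _, _, .comp (c + 1) a b, u, e => by
      obtain ⟨v, w, p, hv, hw, rfl⟩ := (PExpr.eval_comp C f.app).1 e
      rw [C.tgt_comp_succ c v w p (C.meets_tgt p)]
      rw [PExpr.tgt]
      exact (PExpr.eval_comp C f.app).2
        ⟨_, _, _, PExpr.eval_tgt C f a hv, PExpr.eval_tgt C f b hw, rfl⟩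

theorem PExpr.IsPasting.src {X : GSet.{u} n} {k : ℕ} {h : k + 1 ≤ n}
    {a : PExpr X.cell (k + 1) h} (H : a.IsPasting X) : (a.src X).IsPasting X :=
  fun C f => ⟨_, PExpr.eval_src C f a (H C f).choose_spec⟩

theorem PExpr.IsPasting.tgt {X : GSet.{u} n} {k : ℕ} {h : k + 1 ≤ n}
    {a : PExpr X.cell (k + 1) h} (H : a.IsPasting X) : (a.tgt X).IsPasting X :=
  fun C f => ⟨_, PExpr.eval_tgt C f a (H C f).choose_spec⟩

/-- The source of a pasting diagram. -/
def FreeCell.src {X : GSet.{u} n} {k : ℕ} {h : k + 1 ≤ n} :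
    FreeCell X (k + 1) h → FreeCell X k (Nat.le_of_succ_le h) :=
  Quotient.map (fun a => ⟨a.1.src X, a.2.src⟩) fun a b H C f => by
    obtain ⟨v, hv⟩ := a.2 C f
    exact (PExpr.eval_src C f a.1 hv).trans (PExpr.eval_src C f b.1 ((H C f).symm.trans hv)).symm

/-- The target of a pasting diagram. -/
def FreeCell.tgt {X : GSet.{u} n} {k : ℕ} {h : k + 1 ≤ n} :
    FreeCell X (k + 1) h → FreeCell X k (Nat.le_of_succ_le h) :=
  Quotient.map (fun a => ⟨a.1.tgt X, a.2.tgt⟩) fun a b H C f => by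
    obtain ⟨v, hv⟩ := a.2 C f
    exact (PExpr.eval_tgt C f a.1 hv).trans (PExpr.eval_tgt C f b.1 ((H C f).symm.trans hv)).symm

theorem PExpr.Denotes.src {X : GSet.{u} n} {k : ℕ} {h : k + 1 ≤ n} {a : PExpr X.cell (k + 1) h}
    {p : FreeCell X (k + 1) h} (H : a.Denotes X p) : (a.src X).Denotes X p.src := by
  obtain ⟨Ha, rfl⟩ := H
  exact ⟨Ha.src, rfl⟩

theorem PExpr.Denotes.tgt {X : GSet.{u} n} {k : ℕ} {h : k + 1 ≤ n} {a : PExpr X.cell (k + 1) h}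
    {p : FreeCell X (k + 1) h} (H : a.Denotes X p) : (a.tgt X).Denotes X p.tgt := by
  obtain ⟨Ha, rfl⟩ := H
  exact ⟨Ha.tgt, rfl⟩

theorem evalFree_src {X : GSet.{u} n} (C : NCat.{u} n) (f : GMap X C.toGSet) {k : ℕ}
    {h : k + 1 ≤ n} (p : FreeCell X (k + 1) h) : evalFree C f p.src = C.src (evalFree C f p) := by
  obtain ⟨a, H⟩ := exists_denotes p
  exact evalFree_eq C f H.src (PExpr.eval_src C f a (eval_of_denotes C f H))

theorem evalFree_tgt {X : GSet.{u} n} (C : NCat.{u} n) (f : GMap X C.toGSet) {k : ℕ}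
    {h : k + 1 ≤ n} (p : FreeCell X (k + 1) h) : evalFree C f p.tgt = C.tgt (evalFree C f p) := by
  obtain ⟨a, H⟩ := exists_denotes p
  exact evalFree_eq C f H.tgt (PExpr.eval_tgt C f a (eval_of_denotes C f H))

/-- The globular set of pasting diagrams in `X`. -/
def freeGSet (X : GSet.{u} n) : GSet.{u} n where
  cell := FreeCell X
  src := FreeCell.src
  tgt := FreeCell.tgt
  src_src p := evalFree_ext fun C f => by simp only [evalFree_src, evalFree_tgt, C.src_src]
  tgt_tgt p := evalFree_ext fun C f => by simp only [evalFree_src, evalFree_tgt, C.tgt_tgt]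

/-- Evaluation of pasting diagrams, as a morphism of globular sets. -/
noncomputable def evalMap {X : GSet.{u} n} (C : NCat.{u} n) (f : GMap X C.toGSet) :
    GMap (freeGSet X) C.toGSet where
  app p := evalFree C f p
  map_src := evalFree_src C f
  map_tgt := evalFree_tgt C f

/-- The pasting diagram consisting of a single cell. -/
def FreeCell.gen {X : GSet.{u} n} {k : ℕ} {h : k ≤ n} (x : X.cell k h) : FreeCell X k h :=
  PExpr.mk X (.gen x) fun _ f => ⟨f.app x, rfl⟩

theorem FreeCell.gen_denotes {X : GSet.{u} n} {k : ℕ} {h : k ≤ n} (x : X.cell k h) :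
    (PExpr.gen x).Denotes X (FreeCell.gen x) := ⟨_, rfl⟩

theorem evalFree_gen {X : GSet.{u} n} (C : NCat.{u} n) (f : GMap X C.toGSet) {k : ℕ}
    {h : k ≤ n} (x : X.cell k h) : evalFree C f (FreeCell.gen x) = f.app x :=
  evalFree_eq C f (FreeCell.gen_denotes x) rfl

/-- The identity pasting diagram on a pasting diagram. -/
def FreeCell.idn {X : GSet.{u} n} {k : ℕ} {h : k + 1 ≤ n} :
    FreeCell X k (Nat.le_of_succ_le h) → FreeCell X (k + 1) h :=
  Quotient.map
    (fun a => ⟨.idn a.1, fun C f =>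
      (a.2 C f).elim fun v hv => ⟨_, (PExpr.eval_idn C f.app).2 ⟨v, hv, rfl⟩⟩⟩)
    fun _ _ H C f => congrArg (Option.map C.idn) (H C f)

theorem FreeCell.idn_denotes {X : GSet.{u} n} {k : ℕ} {h : k + 1 ≤ n}
    {a : PExpr X.cell k (Nat.le_of_succ_le h)} {p : FreeCell X k (Nat.le_of_succ_le h)}
    (H : a.Denotes X p) : (PExpr.idn (h := h) a).Denotes X (FreeCell.idn p) := by
  obtain ⟨Ha, rfl⟩ := H
  exact ⟨_, rfl⟩

theorem evalFree_idn {X : GSet.{u} n} (C : NCat.{u} n) (f : GMap X C.toGSet) {k : ℕ}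
    {h : k + 1 ≤ n} (p : FreeCell X k (Nat.le_of_succ_le h)) :
    evalFree C f (FreeCell.idn (h := h) p) = C.idn (evalFree C f p) := by
  obtain ⟨a, H⟩ := exists_denotes p
  exact evalFree_eq C f (FreeCell.idn_denotes H)
    ((PExpr.eval_idn C f.app).2 ⟨_, eval_of_denotes C f H, rfl⟩)

theorem isPasting_comp {X : GSet.{u} n} {c k : ℕ} {h : k ≤ n} {p q : FreeCell X k h}
    (m : (freeGSet X).Meets (c + 1) p q) {a b : PExpr X.cell k h} (Ha : a.Denotes X p)
    (Hb : b.Denotes X q) : (PExpr.comp c a b).IsPasting X := fun C f =>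
  ⟨_, (PExpr.eval_comp C f.app).2 ⟨_, _, (evalMap C f).map_meets (c + 1) m,
    eval_of_denotes C f Ha, eval_of_denotes C f Hb, rfl⟩⟩

/-- The composite of two pasting diagrams that meet, denoted by the formal composite of any
expressions for the two. -/
noncomputable def FreeCell.comp {X : GSet.{u} n} (c : ℕ) {k : ℕ} {h : k ≤ n} (p q : FreeCell X k h)
    (m : (freeGSet X).Meets (c + 1) p q) : FreeCell X k h :=
  PExpr.mk X (.comp c (exists_denotes p).choose (exists_denotes q).choose)
    (isPasting_comp m (exists_denotes p).choose_spec (exists_denotes q).choose_spec)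

theorem evalFree_comp {X : GSet.{u} n} (C : NCat.{u} n) (f : GMap X C.toGSet) {c k : ℕ}
    {h : k ≤ n} (p q : FreeCell X k h) (m : (freeGSet X).Meets (c + 1) p q) :
    evalFree C f (FreeCell.comp c p q m) =
      C.comp c (evalFree C f p) (evalFree C f q) ((evalMap C f).map_meets (c + 1) m) :=
  evalFree_eq C f ⟨_, rfl⟩ ((PExpr.eval_comp C f.app).2
    ⟨_, _, _, eval_of_denotes C f (exists_denotes p).choose_spec,
      eval_of_denotes C f (exists_denotes q).choose_spec, rfl⟩)

theorem FreeCell.comp_denotes {X : GSet.{u} n} {c k : ℕ} {h : k ≤ n} {p q : FreeCell X k h}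
    (m : (freeGSet X).Meets (c + 1) p q) {a b : PExpr X.cell k h} (Ha : a.Denotes X p)
    (Hb : b.Denotes X q) : (PExpr.comp c a b).Denotes X (FreeCell.comp c p q m) := by
  refine ⟨isPasting_comp m Ha Hb, evalFree_ext fun C f => ?_⟩
  rw [evalFree_comp]
  exact evalFree_eq C f ⟨_, rfl⟩ ((PExpr.eval_comp C f.app).2
    ⟨_, _, _, eval_of_denotes C f Ha, eval_of_denotes C f Hb, rfl⟩)

/-- The operations on pasting diagrams. -/
noncomputable def freeData (X : GSet.{u} n) : NCatData.{u} n where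
  toGSet := freeGSet X
  idn := FreeCell.idn
  comp c _ _ := FreeCell.comp c

theorem evalFree_srcUnit {X : GSet.{u} n} (C : NCat.{u} n) (f : GMap X C.toGSet) :
    ∀ (c : ℕ) {k : ℕ} {h : k ≤ n} (p : FreeCell X k h),
      evalFree C f ((freeData X).srcUnit c p) = C.srcUnit c (evalFree C f p)
  | 0, _, _, _ => rfl
  | _ + 1, 0, _, _ => rfl
  | c + 1, _ + 1, _, p =>
    (evalFree_idn C f _).trans (congrArg C.idn ((evalFree_srcUnit C f c p.src).trans
      (congrArg (C.srcUnit c) (evalFree_src C f p))))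

theorem evalFree_tgtUnit {X : GSet.{u} n} (C : NCat.{u} n) (f : GMap X C.toGSet) :
    ∀ (c : ℕ) {k : ℕ} {h : k ≤ n} (p : FreeCell X k h),
      evalFree C f ((freeData X).tgtUnit c p) = C.tgtUnit c (evalFree C f p)
  | 0, _, _, _ => rfl
  | _ + 1, 0, _, _ => rfl
  | c + 1, _ + 1, _, p =>
    (evalFree_idn C f _).trans (congrArg C.idn ((evalFree_tgtUnit C f c p.tgt).trans
      (congrArg (C.tgtUnit c) (evalFree_tgt C f p))))

theorem NCatData.comp_congr (C : NCatData.{u} n) {c k : ℕ} {h : k ≤ n} {x x' y y' : C.cell k h}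
    (ex : x = x') (ey : y = y') (p : C.Meets (c + 1) x y) :
    C.comp c x y p = C.comp c x' y' (ex ▸ ey ▸ p) := by
  subst ex; subst ey; rfl

/-- The free strict `n`-category `X^*` on `X`. -/
noncomputable def free (X : GSet.{u} n) : NCat.{u} n where
  toNCatData := freeData X
  src_idn p := evalFree_ext fun C f =>
    (evalFree_src C f _).trans ((congrArg C.src (evalFree_idn C f p)).trans (C.src_idn _))
  tgt_idn p := evalFree_ext fun C f =>
    (evalFree_tgt C f _).trans ((congrArg C.tgt (evalFree_idn C f p)).trans (C.tgt_idn _))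
  src_comp_zero p q m := evalFree_ext fun C f =>
    (evalFree_src C f _).trans ((congrArg C.src (evalFree_comp C f p q m)).trans
      ((C.src_comp_zero _ _ _).trans (evalFree_src C f p).symm))
  tgt_comp_zero p q m := evalFree_ext fun C f =>
    (evalFree_tgt C f _).trans ((congrArg C.tgt (evalFree_comp C f p q m)).trans
      ((C.tgt_comp_zero _ _ _).trans (evalFree_tgt C f q).symm))
  src_comp_succ c _ _ p q m m' := evalFree_ext fun C f => by
    refine (evalFree_src C f _).trans ((congrArg C.src (evalFree_comp C f p q m)).trans ?_)
    refine (C.src_comp_succ c _ _ _ (C.meets_src ((evalMap C f).map_meets _ m))).trans ?_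
    refine Eq.trans ?_ (evalFree_comp C f _ _ m').symm
    exact C.comp_congr (evalFree_src C f p).symm (evalFree_src C f q).symm _
  tgt_comp_succ c _ _ p q m m' := evalFree_ext fun C f => by
    refine (evalFree_tgt C f _).trans ((congrArg C.tgt (evalFree_comp C f p q m)).trans ?_)
    refine (C.tgt_comp_succ c _ _ _ (C.meets_tgt ((evalMap C f).map_meets _ m))).trans ?_
    refine Eq.trans ?_ (evalFree_comp C f _ _ m').symm
    exact C.comp_congr (evalFree_tgt C f p).symm (evalFree_tgt C f q).symm _
  assoc c _ _ p q r m m' w w' := evalFree_ext fun C f => by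
    refine (evalFree_comp C f _ _ w).trans ?_
    refine Eq.trans ?_ (evalFree_comp C f _ _ w').symm
    refine (C.comp_congr (evalFree_comp C f p q m) rfl _).trans ?_
    refine Eq.trans ?_ (C.comp_congr rfl (evalFree_comp C f q r m') _).symm
    exact C.assoc c _ _ _ _ _ _ _
  unit_comp c _ _ p m := evalFree_ext fun C f =>
    (evalFree_comp C f _ _ m).trans ((C.comp_congr (evalFree_srcUnit C f _ p) rfl _).trans
      (C.unit_comp c _ _))
  comp_unit c _ _ p m := evalFree_ext fun C f =>
    (evalFree_comp C f _ _ m).trans ((C.comp_congr rfl (evalFree_tgtUnit C f _ p) _).trans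
      (C.comp_unit c _ _))
  interchange c d hcd _ _ x y x' y' p p' q q' r r' := evalFree_ext fun C f => by
    refine (evalFree_comp C f _ _ r).trans ?_
    refine Eq.trans ?_ (evalFree_comp C f _ _ r').symm
    refine (C.comp_congr (evalFree_comp C f x y p) (evalFree_comp C f x' y' p') _).trans ?_
    refine Eq.trans ?_
      (C.comp_congr (evalFree_comp C f x x' q) (evalFree_comp C f y y' q') _).symm
    exact C.interchange c d hcd _ _ _ _ _ _ _ _ _ _
  idn_comp c _ _ p q m m' := evalFree_ext fun C f => by
    refine (evalFree_idn C f _).trans ((congrArg C.idn (evalFree_comp C f p q m)).trans ?_)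
    refine Eq.trans ?_ (evalFree_comp C f _ _ m').symm
    refine Eq.trans ?_
      (C.comp_congr (evalFree_idn C f p) (evalFree_idn C f q) _).symm
    exact C.idn_comp c _ _ _ _

/-- The inclusion `η : X ⟶ X^*` of the single cells; the unit of the monad `(-)^*`. -/
def unitMap (X : GSet.{u} n) : GMap X (freeGSet X) where
  app x := FreeCell.gen x
  map_src x := Quotient.sound fun C f => by
    change PExpr.eval C f.app (PExpr.gen _) = PExpr.eval C f.app (PExpr.src X (PExpr.gen _))
    rw [PExpr.src]
  map_tgt x := Quotient.sound fun C f => by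
    change PExpr.eval C f.app (PExpr.gen _) = PExpr.eval C f.app (PExpr.tgt X (PExpr.gen _))
    rw [PExpr.tgt]

/-- A morphism of globular sets between strict `n`-categories is a strict `n`-functor if it
preserves identities and composition. -/
structure IsNFunctor {C D : NCat.{u} n} (F : GMap C.toGSet D.toGSet) : Prop where
  map_idn : ∀ {k : ℕ} {h : k + 1 ≤ n} (x : C.cell k (Nat.le_of_succ_le h)),
    F.app (C.idn (h := h) x) = D.idn (F.app x)
  map_comp : ∀ (c : ℕ) {k : ℕ} {h : k ≤ n} (x y : C.cell k h) (p : C.Meets (c + 1) x y),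
    F.app (C.comp c x y p) = D.comp c (F.app x) (F.app y) (F.map_meets (c + 1) p)

theorem PExpr.eval_functor {X : (k : ℕ) → k ≤ n → Type u} {C D : NCat.{u} n}
    (f : ∀ {k : ℕ} {h : k ≤ n}, X k h → C.cell k h) {F : GMap C.toGSet D.toGSet}
    (HF : IsNFunctor F) : ∀ {k : ℕ} {h : k ≤ n} (a : PExpr X k h) {v : C.cell k h},
      a.eval C f = some v → a.eval D (fun x => F.app (f x)) = some (F.app v)
  | _, _, .gen x, v, e => congrArg some (congrArg F.app (Option.some.inj e))
  | _, _, .idn a, v, e => by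
      obtain ⟨w, hw, rfl⟩ := (PExpr.eval_idn C f).1 e
      exact (PExpr.eval_idn D _).2 ⟨_, PExpr.eval_functor f HF a hw, HF.map_idn w⟩
  | _, _, .comp c a b, v, e => by
      obtain ⟨v, w, p, hv, hw, rfl⟩ := (PExpr.eval_comp C f).1 e
      exact (PExpr.eval_comp D _).2 ⟨_, _, F.map_meets (c + 1) p, PExpr.eval_functor f HF a hv,
        PExpr.eval_functor f HF b hw, HF.map_comp c v w p⟩

theorem isNFunctor_evalMap {X : GSet.{u} n} (C : NCat.{u} n) (f : GMap X C.toGSet) :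
    IsNFunctor (C := free X) (evalMap C f) where
  map_idn p := evalFree_idn C f p
  map_comp _ _ _ p q m := evalFree_comp C f p q m

theorem evalFree_functor {X : GSet.{u} n} {C D : NCat.{u} n} (f : GMap X C.toGSet)
    {F : GMap C.toGSet D.toGSet} (HF : IsNFunctor F) {k : ℕ} {h : k ≤ n} (p : FreeCell X k h) :
    F.app (evalFree C f p) = evalFree D (F.comp f) p := by
  obtain ⟨a, H⟩ := exists_denotes p
  exact (evalFree_eq D (F.comp f) H
    (PExpr.eval_functor f.app HF a (eval_of_denotes C f H))).symm

theorem evalFree_self {X : GSet.{u} n} {k : ℕ} {h : k ≤ n} (p : FreeCell X k h) :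
    evalFree (free X) (unitMap X) p = p := evalFree_ext fun C f => by
  refine (evalFree_functor (unitMap X) (isNFunctor_evalMap C f) p).trans ?_
  congr 1
  exact GMap.ext fun k h x => evalFree_gen C f x

theorem FreeCell.induction {X : GSet.{u} n} {P : ∀ {k : ℕ} {h : k ≤ n}, FreeCell X k h → Prop}
    (gen : ∀ {k : ℕ} {h : k ≤ n} (x : X.cell k h), P (FreeCell.gen x))
    (idn : ∀ {k : ℕ} {h : k + 1 ≤ n} (p : FreeCell X k (Nat.le_of_succ_le h)),
      P p → P (FreeCell.idn (h := h) p))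
    (comp : ∀ (c : ℕ) {k : ℕ} {h : k ≤ n} (p q : FreeCell X k h)
      (m : (freeGSet X).Meets (c + 1) p q), P p → P q → P (FreeCell.comp c p q m))
    {k : ℕ} {h : k ≤ n} (p : FreeCell X k h) : P p := by
  have key : ∀ {k : ℕ} {h : k ≤ n} (a : PExpr X.cell k h) (p : FreeCell X k h),
      a.eval (free X) (unitMap X).app = some p → P p := by
    intro k h a
    induction a with
    | gen x => intro p e; cases Option.some.inj e; exact gen x
    | idn a ih =>
      intro p e
      obtain ⟨q, hq, rfl⟩ := (PExpr.eval_idn _ _).1 e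
      exact idn q (ih q hq)
    | comp c a b iha ihb =>
      intro p e
      obtain ⟨q, r, m, hq, hr, rfl⟩ := (PExpr.eval_comp _ _).1 e
      exact comp c q r m (iha q hq) (ihb r hr)
  obtain ⟨a, H⟩ := exists_denotes p
  exact key a p ((eval_of_denotes _ _ H).trans (congrArg some (evalFree_self p)))

/-- `X^*` is the free strict `n`-category on `X`: every morphism from `X` to a strict `n`-category
extends uniquely to a strict `n`-functor on `X^*`. -/
theorem free_universal {X : GSet.{u} n} (C : NCat.{u} n) (f : GMap X C.toGSet) :
    ∃! F : GMap (free X).toGSet C.toGSet, IsNFunctor F ∧ F.comp (unitMap X) = f := by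
  refine ⟨evalMap C f, ⟨isNFunctor_evalMap C f, GMap.ext fun _ _ x => evalFree_gen C f x⟩, ?_⟩
  rintro F ⟨HF, rfl⟩
  refine GMap.ext fun k h p => ?_
  refine Eq.trans (congrArg F.app (evalFree_self p).symm) ?_
  exact evalFree_functor (unitMap X) HF p

/-- The morphism `f^* : X^* ⟶ Y^*` induced by `f`, which relabels pasting diagrams. -/
noncomputable def freeMap {X Y : GSet.{u} n} (f : GMap X Y) : GMap (freeGSet X) (freeGSet Y) :=
  evalMap (free Y) ((unitMap Y).comp f)

/-- The multiplication `μ : X^** ⟶ X^*` of the monad `(-)^*`, which composes pasting diagrams of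
pasting diagrams. -/
noncomputable def multMap (X : GSet.{u} n) : GMap (freeGSet (freeGSet X)) (freeGSet X) :=
  evalMap (free X) (GMap.id (freeGSet X))

theorem freeMap_gen {X Y : GSet.{u} n} (f : GMap X Y) {k : ℕ} {h : k ≤ n} (x : X.cell k h) :
    (freeMap f).app (FreeCell.gen x) = FreeCell.gen (f.app x) := evalFree_gen _ _ x

theorem freeMap_freeMap {X Y Z : GSet.{u} n} (g : GMap Y Z) (f : GMap X Y) {k : ℕ} {h : k ≤ n}
    (p : FreeCell X k h) :
    (freeMap g).app ((freeMap f).app p) = (freeMap (g.comp f)).app p := by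
  refine (evalFree_functor _ (isNFunctor_evalMap (free Z) ((unitMap Z).comp g)) p).trans ?_
  change evalFree _ _ p = evalFree _ _ p
  congr 1
  exact GMap.ext fun _ _ x => evalFree_gen _ _ _

theorem freeMap_id {X : GSet.{u} n} {k : ℕ} {h : k ≤ n} (p : FreeCell X k h) :
    (freeMap (GMap.id X)).app p = p := evalFree_self p

theorem multMap_natural {X Y : GSet.{u} n} (f : GMap X Y) {k : ℕ} {h : k ≤ n}
    (p : FreeCell (freeGSet X) k h) :
    (freeMap f).app ((multMap X).app p) = (multMap Y).app ((freeMap (freeMap f)).app p) := by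
  refine (evalFree_functor _ (isNFunctor_evalMap (free Y) ((unitMap Y).comp f)) p).trans ?_
  refine Eq.trans ?_ (evalFree_functor _
    (isNFunctor_evalMap (free Y) (GMap.id (freeGSet Y))) p).symm
  congr 1
  exact GMap.ext fun _ _ x => (evalFree_gen _ _ _).symm

theorem multMap_multMap {X : GSet.{u} n} {k : ℕ} {h : k ≤ n}
    (p : FreeCell (freeGSet (freeGSet X)) k h) :
    (multMap X).app ((multMap (freeGSet X)).app p) =
      (multMap X).app ((freeMap (multMap X)).app p) := by
  refine (evalFree_functor _ (isNFunctor_evalMap (free X) (GMap.id (freeGSet X))) p).trans ?_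
  refine Eq.trans ?_ (evalFree_functor _
    (isNFunctor_evalMap (free X) (GMap.id (freeGSet X))) p).symm
  congr 1
  exact GMap.ext fun _ _ x => (evalFree_gen _ _ _).symm

theorem multMap_gen {X : GSet.{u} n} {k : ℕ} {h : k ≤ n} (p : FreeCell X k h) :
    (multMap X).app (FreeCell.gen (X := freeGSet X) p) = p :=
  evalFree_gen (free X) (GMap.id (freeGSet X)) p

theorem multMap_freeMap_unitMap {X : GSet.{u} n} {k : ℕ} {h : k ≤ n} (p : FreeCell X k h) :
    (multMap X).app ((freeMap (unitMap X)).app p) = p := by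
  refine (evalFree_functor _ (isNFunctor_evalMap (free X) (GMap.id (freeGSet X))) p).trans ?_
  refine Eq.trans ?_ (evalFree_self p)
  congr 1
  exact GMap.ext fun _ _ x => evalFree_gen _ _ _

/-- The source of a pasting diagram in `1` equals its target. -/
theorem one_src_eq_tgt : ∀ {k : ℕ} {h : k + 1 ≤ n} (τ : FreeCell (one.{u} n) (k + 1) h),
    τ.src = τ.tgt := by
  let P : ∀ {k : ℕ} {h : k ≤ n}, FreeCell (one.{u} n) k h → Prop := fun {k} =>
    match k with
    | 0 => fun _ => True
    | _ + 1 => fun τ => τ.src = τ.tgt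
  have key : ∀ {k : ℕ} {h : k ≤ n} (τ : FreeCell (one.{u} n) k h), P τ := by
    intro k h τ
    induction τ using FreeCell.induction with
    | @gen k h x =>
      cases k with
      | zero => trivial
      | succ k => exact ((unitMap (one n)).map_src x).symm.trans ((unitMap (one n)).map_tgt x)
    | idn p _ => exact ((free (one n)).src_idn p).trans ((free (one n)).tgt_idn p).symm
    | @comp c k h p q m ihp ihq =>
      cases k with
      | zero => trivial
      | succ k =>
        have ep : FreeCell.src p = FreeCell.tgt p := ihp
        have eq : FreeCell.src q = FreeCell.tgt q := ihq
        cases c with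
        | zero =>
          refine ((free (one n)).src_comp_zero p q m).trans ?_
          refine Eq.trans ?_ ((free (one n)).tgt_comp_zero p q m).symm
          have m' : FreeCell.tgt p = FreeCell.src q := m
          exact ep.trans (m'.trans eq)
        | succ c =>
          refine ((free (one n)).src_comp_succ c p q m (GSet.meets_src _ m)).trans ?_
          refine Eq.trans ?_ ((free (one n)).tgt_comp_succ c p q m (GSet.meets_tgt _ m)).symm
          exact NCatData.comp_congr (freeData (one n)) ep eq _
  intro k h τ
  exact key τ

/-- The boundary `∂τ` of a pasting diagram `τ` in `1`, i.e. its source, which is its target. -/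
def bdry {k : ℕ} {h : k + 1 ≤ n} (τ : FreeCell (one.{u} n) (k + 1) h) :
    FreeCell (one.{u} n) k (Nat.le_of_succ_le h) := τ.src

/-! ### Globular collections and globular operads -/

/-- An `n`-globular collection: an `n`-globular set `G` with a morphism `G ⟶ 1^*`. -/
structure GColl (n : ℕ) extends GSet.{u} n where
  shape : GMap toGSet (freeGSet (one.{u} n))

/-- Morphisms of `n`-globular collections. -/
structure CollHom (G H : GColl.{u} n) extends GMap G.toGSet H.toGSet where
  map_shape : ∀ {k : ℕ} {h : k ≤ n} (x : G.cell k h), H.shape.app (app x) = G.shape.app x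

theorem CollHom.ext {G H : GColl.{u} n} {f g : CollHom G H}
    (E : ∀ (k : ℕ) (h : k ≤ n) (x : G.cell k h), f.app x = g.app x) : f = g := by
  obtain ⟨f, _⟩ := f
  obtain ⟨g, _⟩ := g
  have : f = g := GMap.ext E
  subst this
  rfl

/-- The identity morphism. -/
def CollHom.id (G : GColl.{u} n) : CollHom G G where
  toGMap := GMap.id G.toGSet
  map_shape _ := rfl

/-- Composition, `g` after `f`. -/
def CollHom.comp {G H K : GColl.{u} n} (g : CollHom H K) (f : CollHom G H) : CollHom G K where
  toGMap := g.toGMap.comp f.toGMap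
  map_shape x := (g.map_shape _).trans (f.map_shape x)

/-- The unit collection `η : 1 ⟶ 1^*`. -/
def unitColl (n : ℕ) : GColl.{u} n where
  toGSet := one n
  shape := unitMap (one n)

/-- The collection `G ∘ H`: the pullback of `!^* : G^* ⟶ 1^*` along `H ⟶ 1^*`, with the morphism
`G ∘ H ⟶ G^* ⟶ 1^** ⟶ 1^*`. -/
noncomputable def tensor (G H : GColl.{u} n) : GColl.{u} n where
  cell k h := {x : FreeCell G.toGSet k h × H.cell k h //
    (freeMap (bang G.toGSet)).app x.1 = H.shape.app x.2}
  src x := ⟨((freeGSet G.toGSet).src x.1.1, H.src x.1.2),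
    ((freeMap (bang G.toGSet)).map_src x.1.1).trans
      ((congrArg (freeGSet (one n)).src x.2).trans (H.shape.map_src x.1.2).symm)⟩
  tgt x := ⟨((freeGSet G.toGSet).tgt x.1.1, H.tgt x.1.2),
    ((freeMap (bang G.toGSet)).map_tgt x.1.1).trans
      ((congrArg (freeGSet (one n)).tgt x.2).trans (H.shape.map_tgt x.1.2).symm)⟩
  src_src x := Subtype.ext (Prod.ext ((freeGSet G.toGSet).src_src x.1.1) (H.src_src x.1.2))
  tgt_tgt x := Subtype.ext (Prod.ext ((freeGSet G.toGSet).tgt_tgt x.1.1) (H.tgt_tgt x.1.2))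
  shape :=
    { app := fun x => (multMap (one n)).app ((freeMap G.shape).app x.1.1)
      map_src := fun x => ((multMap (one n)).comp (freeMap G.shape)).map_src x.1.1
      map_tgt := fun x => ((multMap (one n)).comp (freeMap G.shape)).map_tgt x.1.1 }

/-- The projection `G ∘ H ⟶ G^*`. -/
def tensorFst (G H : GColl.{u} n) : GMap (tensor G H).toGSet (freeGSet G.toGSet) where
  app x := x.1.1
  map_src _ := rfl
  map_tgt _ := rfl

/-- The projection `G ∘ H ⟶ H`. -/
def tensorSnd (G H : GColl.{u} n) : GMap (tensor G H).toGSet H.toGSet where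
  app x := x.1.2
  map_src _ := rfl
  map_tgt _ := rfl

theorem freeMap_bang {X Y : GSet.{u} n} (f : GMap X Y) {k : ℕ} {h : k ≤ n} (p : FreeCell X k h) :
    (freeMap (bang Y)).app ((freeMap f).app p) = (freeMap (bang X)).app p :=
  freeMap_freeMap (bang Y) f p

theorem freeMap_shape {G H : GColl.{u} n} (f : CollHom G H) {k : ℕ} {h : k ≤ n}
    (p : FreeCell G.toGSet k h) :
    (freeMap H.shape).app ((freeMap f.toGMap).app p) = (freeMap G.shape).app p := by
  rw [freeMap_freeMap]
  congr 2
  exact GMap.ext fun _ _ x => f.map_shape x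

/-- The functoriality of `∘`. -/
noncomputable def tensorMap {G G' H H' : GColl.{u} n} (f : CollHom G G') (g : CollHom H H') :
    CollHom (tensor G H) (tensor G' H') where
  app x := ⟨((freeMap f.toGMap).app x.1.1, g.app x.1.2),
    (freeMap_bang f.toGMap x.1.1).trans (x.2.trans (g.map_shape x.1.2).symm)⟩
  map_src x := Subtype.ext (Prod.ext ((freeMap f.toGMap).map_src x.1.1) (g.map_src x.1.2))
  map_tgt x := Subtype.ext (Prod.ext ((freeMap f.toGMap).map_tgt x.1.1) (g.map_tgt x.1.2))
  map_shape x := congrArg (multMap (one n)).app (freeMap_shape f x.1.1)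

/-- The canonical morphism `G ⟶ 1 ∘ G`. -/
noncomputable def leftUnit (G : GColl.{u} n) : GMap G.toGSet (tensor (unitColl n) G).toGSet where
  app x := ⟨(G.shape.app x, x), freeMap_id (G.shape.app x)⟩
  map_src x := Subtype.ext (Prod.ext (G.shape.map_src x) rfl)
  map_tgt x := Subtype.ext (Prod.ext (G.shape.map_tgt x) rfl)

/-- The canonical morphism `G ⟶ G ∘ 1`. -/
noncomputable def rightUnit (G : GColl.{u} n) : GMap G.toGSet (tensor G (unitColl n)).toGSet where
  app x := ⟨(FreeCell.gen x, PUnit.unit), freeMap_gen (bang G.toGSet) x⟩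
  map_src x := Subtype.ext (Prod.ext ((unitMap G.toGSet).map_src x) rfl)
  map_tgt x := Subtype.ext (Prod.ext ((unitMap G.toGSet).map_tgt x) rfl)

/-- The canonical morphism `(G ∘ H) ∘ K ⟶ G ∘ (H ∘ K)`. -/
noncomputable def assocMap (G H K : GColl.{u} n) :
    GMap (tensor (tensor G H) K).toGSet (tensor G (tensor H K)).toGSet where
  app x := ⟨((multMap G.toGSet).app ((freeMap (tensorFst G H)).app x.1.1),
      ⟨((freeMap (tensorSnd G H)).app x.1.1, x.1.2),
        (freeMap_bang (tensorSnd G H) x.1.1).trans x.2⟩), by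
    refine (multMap_natural _ _).trans (congrArg (multMap (one n)).app ?_)
    refine (freeMap_freeMap _ _ _).trans ((freeMap_freeMap _ _ _).trans ?_).symm
    congr 2
    exact GMap.ext fun _ _ y => y.2.symm⟩
  map_src x := by
    refine Subtype.ext (Prod.ext ?_ (Subtype.ext (Prod.ext ?_ rfl)))
    · exact (congrArg (multMap G.toGSet).app ((freeMap (tensorFst G H)).map_src x.1.1)).trans
        ((multMap G.toGSet).map_src _)
    · exact (freeMap (tensorSnd G H)).map_src x.1.1
  map_tgt x := by
    refine Subtype.ext (Prod.ext ?_ (Subtype.ext (Prod.ext ?_ rfl)))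
    · exact (congrArg (multMap G.toGSet).app ((freeMap (tensorFst G H)).map_tgt x.1.1)).trans
        ((multMap G.toGSet).map_tgt _)
    · exact (freeMap (tensorSnd G H)).map_tgt x.1.1

/-- An `n`-globular operad: a monoid in `n`-globular collections with respect to `∘`. -/
structure Operad (n : ℕ) extends GColl.{u} n where
  ids : CollHom (unitColl n) toGColl
  comp : CollHom (tensor toGColl toGColl) toGColl
  ids_comp : ∀ {k : ℕ} {h : k ≤ n} (x : cell k h),
    comp.app ((tensorMap ids (CollHom.id toGColl)).app ((leftUnit toGColl).app x)) = x
  comp_ids : ∀ {k : ℕ} {h : k ≤ n} (x : cell k h),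
    comp.app ((tensorMap (CollHom.id toGColl) ids).app ((rightUnit toGColl).app x)) = x
  assoc : ∀ {k : ℕ} {h : k ≤ n} (x : (tensor (tensor toGColl toGColl) toGColl).cell k h),
    comp.app ((tensorMap comp (CollHom.id toGColl)).app x) =
      comp.app ((tensorMap (CollHom.id toGColl) comp).app
        ((assocMap toGColl toGColl toGColl).app x))

/-- The identity `k`-cell `id_k` of an operad. -/
def Operad.idCell (G : Operad.{u} n) {k : ℕ} {h : k ≤ n} : G.cell k h := G.ids.app PUnit.unit

/-- Morphisms of `n`-globular operads. -/
structure OperadHom (G H : Operad.{u} n) extends CollHom G.toGColl H.toGColl where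
  map_ids : ∀ {k : ℕ} {h : k ≤ n} (x : (unitColl n).cell k h),
    app (G.ids.app x) = H.ids.app x
  map_comp : ∀ {k : ℕ} {h : k ≤ n} (x : (tensor G.toGColl G.toGColl).cell k h),
    app (G.comp.app x) = H.comp.app ((tensorMap toCollHom toCollHom).app x)

/-! ### Contractions -/

/-- `(x, x', τ)` is admissible if `x`, `x'` are parallel `k`-cells of `G` and `τ` is a
`(k + 1)`-pasting diagram in `1` such that the shapes of `x` and `x'` are `∂τ`. -/
structure GColl.Admissible (G : GColl.{u} n) {k : ℕ} {h : k + 1 ≤ n}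
    (x x' : G.cell k (Nat.le_of_succ_le h)) (τ : FreeCell (one.{u} n) (k + 1) h) : Prop where
  parallel : G.Parallel x x'
  shape_left : G.shape.app x = bdry τ
  shape_right : G.shape.app x' = bdry τ

/-- A contraction function assigns to each admissible triple `(x, x', τ)` a cell `x ⟶ x'` of
shape `τ`. -/
structure Contraction (G : GColl.{u} n) where
  cell : ∀ {k : ℕ} {h : k + 1 ≤ n} (x x' : G.cell k (Nat.le_of_succ_le h))
    (τ : FreeCell (one.{u} n) (k + 1) h), G.Admissible x x' τ → G.cell (k + 1) h
  src_cell : ∀ {k : ℕ} {h : k + 1 ≤ n} (x x' : G.cell k (Nat.le_of_succ_le h))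
    (τ : FreeCell (one.{u} n) (k + 1) h) (H : G.Admissible x x' τ), G.src (cell x x' τ H) = x
  tgt_cell : ∀ {k : ℕ} {h : k + 1 ≤ n} (x x' : G.cell k (Nat.le_of_succ_le h))
    (τ : FreeCell (one.{u} n) (k + 1) h) (H : G.Admissible x x' τ), G.tgt (cell x x' τ H) = x'
  shape_cell : ∀ {k : ℕ} {h : k + 1 ≤ n} (x x' : G.cell k (Nat.le_of_succ_le h))
    (τ : FreeCell (one.{u} n) (k + 1) h) (H : G.Admissible x x' τ),
    G.shape.app (cell x x' τ H) = τ

/-- Any two parallel `n`-cells of the same shape are equal. -/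
def GColl.TopUnique (G : GColl.{u} n) : Prop :=
  ∀ x x' : G.cell n le_rfl, G.Parallel x x' → G.shape.app x = G.shape.app x' → x = x'

/-- An `n`-globular operad is contractible if it has a contraction function and parallel `n`-cells
of the same shape are equal. -/
def Operad.IsContractible (G : Operad.{u} n) : Prop :=
  Nonempty (Contraction G.toGColl) ∧ G.TopUnique

/-- Contractible `n`-globular operads with a specified contraction. -/
structure CGOp (n : ℕ) extends Operad.{u} n where
  contraction : Contraction toGColl
  topUnique : toGColl.TopUnique

theorem CGOp.isContractible (G : CGOp.{u} n) : G.toOperad.IsContractible :=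
  ⟨⟨G.contraction⟩, G.topUnique⟩

theorem CollHom.map_admissible {G H : GColl.{u} n} (f : CollHom G H) {k : ℕ} {h : k + 1 ≤ n}
    {x x' : G.cell k (Nat.le_of_succ_le h)} {τ : FreeCell (one.{u} n) (k + 1) h}
    (A : G.Admissible x x' τ) : H.Admissible (f.app x) (f.app x') τ where
  parallel := by
    cases k with
    | zero => trivial
    | succ k =>
      have P : G.src x = G.src x' ∧ G.tgt x = G.tgt x' := A.parallel
      refine ⟨?_, ?_⟩
      · rw [← f.map_src, ← f.map_src, P.1]
      · rw [← f.map_tgt, ← f.map_tgt, P.2]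
  shape_left := (f.map_shape x).trans A.shape_left
  shape_right := (f.map_shape x').trans A.shape_right

/-- Contraction preserving morphisms of `n`-globular operads. -/
structure CGOpHom (G H : CGOp.{u} n) extends OperadHom G.toOperad H.toOperad where
  map_contraction : ∀ {k : ℕ} {h : k + 1 ≤ n} (x x' : G.cell k (Nat.le_of_succ_le h))
    (τ : FreeCell (one.{u} n) (k + 1) h) (A : G.Admissible x x' τ),
    app (G.contraction.cell x x' τ A) =
      H.contraction.cell (app x) (app x') τ (toCollHom.map_admissible A)

theorem CGOpHom.ext {G H : CGOp.{u} n} {f g : CGOpHom G H}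
    (E : ∀ (k : ℕ) (h : k ≤ n) (x : G.cell k h), f.app x = g.app x) : f = g := by
  obtain ⟨⟨f, _, _⟩, _⟩ := f
  obtain ⟨⟨g, _, _⟩, _⟩ := g
  have : f = g := CollHom.ext E
  subst this
  rfl

theorem tensorMap_comp {G H K : GColl.{u} n} (g : CollHom H K) (f : CollHom G H) {k : ℕ}
    {h : k ≤ n} (x : (tensor G G).cell k h) :
    (tensorMap g g).app ((tensorMap f f).app x) = (tensorMap (g.comp f) (g.comp f)).app x :=
  Subtype.ext (Prod.ext (freeMap_freeMap g.toGMap f.toGMap x.1.1) rfl)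

theorem tensorMap_id {G H : GColl.{u} n} {k : ℕ} {h : k ≤ n} (x : (tensor G H).cell k h) :
    (tensorMap (CollHom.id G) (CollHom.id H)).app x = x :=
  Subtype.ext (Prod.ext (freeMap_id x.1.1) rfl)

/-- The identity morphism. -/
def CGOpHom.id (G : CGOp.{u} n) : CGOpHom G G where
  toCollHom := CollHom.id G.toGColl
  map_ids _ := rfl
  map_comp x := congrArg G.comp.app (tensorMap_id x).symm
  map_contraction _ _ _ _ := rfl

/-- Composition, `g` after `f`. -/
def CGOpHom.comp {G H K : CGOp.{u} n} (g : CGOpHom H K) (f : CGOpHom G H) : CGOpHom G K where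
  toCollHom := g.toCollHom.comp f.toCollHom
  map_ids x := (congrArg g.app (f.map_ids x)).trans (g.map_ids x)
  map_comp x := (congrArg g.app (f.map_comp x)).trans ((g.map_comp _).trans
    (congrArg K.comp.app (tensorMap_comp g.toCollHom f.toCollHom x)))
  map_contraction x x' τ A := (congrArg g.app (f.map_contraction x x' τ A)).trans
    (g.map_contraction _ _ τ (f.map_admissible A))

/-- The category of `n`-globular operads with contraction. -/
instance (n : ℕ) : CategoryTheory.Category (CGOp.{u} n) where
  Hom := CGOpHom
  id := CGOpHom.id
  comp f g := CGOpHom.comp g f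

/-! ### The operad `I_n` -/

/-- Formal composites of identity cells and contraction cells; a contraction cell
`contr x x' τ` is a formal cell `x ⟶ x'` of shape `τ`. -/
inductive OExpr (n : ℕ) : (k : ℕ) → k ≤ n → Type u
  | ident {k : ℕ} {h : k ≤ n} : OExpr n k h
  | contr {k : ℕ} {h : k + 1 ≤ n} (x x' : OExpr n k (Nat.le_of_succ_le h))
      (τ : FreeCell (one.{u} n) (k + 1) h) : OExpr n (k + 1) h
  | comp {k : ℕ} {h : k ≤ n} (P : PExpr (OExpr n) k h) (Λ : OExpr n k h) : OExpr n k h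
  | src {k : ℕ} {h : k + 1 ≤ n} (a : OExpr n (k + 1) h) : OExpr n k (Nat.le_of_succ_le h)
  | tgt {k : ℕ} {h : k + 1 ≤ n} (a : OExpr n (k + 1) h) : OExpr n k (Nat.le_of_succ_le h)

/-- `OExpr.Rel τ a b`: the expressions `a`, `b` denote the same cell of `I_n`, of shape `τ`. -/
inductive OExpr.Rel : {k : ℕ} → {h : k ≤ n} → FreeCell (one.{u} n) k h →
    OExpr.{u} n k h → OExpr.{u} n k h → Prop
  | symm {k : ℕ} {h : k ≤ n} {τ : FreeCell (one n) k h} {a b : OExpr n k h} :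
      Rel τ a b → Rel τ b a
  | trans {k : ℕ} {h : k ≤ n} {τ : FreeCell (one n) k h} {a b c : OExpr n k h} :
      Rel τ a b → Rel τ b c → Rel τ a c
  | src_congr {k : ℕ} {h : k + 1 ≤ n} {τ : FreeCell (one n) (k + 1) h} {a b : OExpr n (k + 1) h} :
      Rel τ a b → Rel τ.src a.src b.src
  | tgt_congr {k : ℕ} {h : k + 1 ≤ n} {τ : FreeCell (one n) (k + 1) h} {a b : OExpr n (k + 1) h} :
      Rel τ a b → Rel τ.tgt a.tgt b.tgt
  | src_src {k : ℕ} {h : k + 1 + 1 ≤ n} {τ : FreeCell (one n) (k + 1 + 1) h}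
      {a : OExpr n (k + 1 + 1) h} : Rel τ a a → Rel τ.src.src a.src.src a.tgt.src
  | tgt_tgt {k : ℕ} {h : k + 1 + 1 ≤ n} {τ : FreeCell (one n) (k + 1 + 1) h}
      {a : OExpr n (k + 1 + 1) h} : Rel τ a a → Rel τ.tgt.tgt a.src.tgt a.tgt.tgt
  /- identity cells -/
  | ident {k : ℕ} {h : k ≤ n} :
      Rel (FreeCell.gen (X := one n) PUnit.unit) (.ident : OExpr n k h) .ident
  | src_ident {k : ℕ} {h : k + 1 ≤ n} :
      Rel (FreeCell.gen (X := one n) PUnit.unit) (OExpr.ident : OExpr n (k + 1) h).src .ident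
  | tgt_ident {k : ℕ} {h : k + 1 ≤ n} :
      Rel (FreeCell.gen (X := one n) PUnit.unit) (OExpr.ident : OExpr n (k + 1) h).tgt .ident
  /- contraction cells: one for each admissible triple -/
  | contr_zero {h : 0 + 1 ≤ n} {τ : FreeCell (one n) (0 + 1) h}
      {x y x' y' : OExpr n 0 (Nat.le_of_succ_le h)} :
      Rel (bdry τ) x y → Rel (bdry τ) x' y' → Rel τ (.contr x x' τ) (.contr y y' τ)
  | contr_succ {k : ℕ} {h : k + 1 + 1 ≤ n} {τ : FreeCell (one n) (k + 1 + 1) h}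
      {x y x' y' : OExpr n (k + 1) (Nat.le_of_succ_le h)} :
      Rel (bdry τ) x y → Rel (bdry τ) x' y' →
      Rel (bdry (bdry τ)) x.src x'.src → Rel (bdry (bdry τ)) x.tgt x'.tgt →
      Rel τ (.contr x x' τ) (.contr y y' τ)
  | src_contr {k : ℕ} {h : k + 1 ≤ n} {τ : FreeCell (one n) (k + 1) h}
      {x x' : OExpr n k (Nat.le_of_succ_le h)} :
      Rel τ (.contr x x' τ) (.contr x x' τ) → Rel (bdry τ) (OExpr.contr x x' τ).src x
  | tgt_contr {k : ℕ} {h : k + 1 ≤ n} {τ : FreeCell (one n) (k + 1) h}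
      {x x' : OExpr n k (Nat.le_of_succ_le h)} :
      Rel τ (.contr x x' τ) (.contr x x' τ) → Rel (bdry τ) (OExpr.contr x x' τ).tgt x'
  /- composites `Λ ∘ (f z)_z` of a cell `Λ` with a pasting diagram of cells, given by a pasting
  diagram `p` in a globular set `Z` and a labelling `f` of the cells of `Z` -/
  | comp_congr {Z : GSet.{u} n} (γ : GMap Z (freeGSet (one n)))
      (f f' : ∀ {j : ℕ} {hj : j ≤ n}, Z.cell j hj → OExpr n j hj)
      (hf : ∀ {j : ℕ} {hj : j ≤ n} (z : Z.cell j hj), Rel (γ.app z) (f z) (f' z))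
      (hs : ∀ {j : ℕ} {hj : j + 1 ≤ n} (z : Z.cell (j + 1) hj),
        Rel (γ.app (Z.src z)) (f (Z.src z)) (f z).src)
      (ht : ∀ {j : ℕ} {hj : j + 1 ≤ n} (z : Z.cell (j + 1) hj),
        Rel (γ.app (Z.tgt z)) (f (Z.tgt z)) (f z).tgt)
      {k : ℕ} {h : k ≤ n} {p : FreeCell Z k h} {a a' : PExpr Z.cell k h}
      (ha : a.Denotes Z p) (ha' : a'.Denotes Z p) {Λ Λ' : OExpr n k h}
      (hΛ : Rel ((freeMap (bang Z)).app p) Λ Λ') :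
      Rel ((multMap (one n)).app ((freeMap γ).app p)) (.comp (a.map f) Λ) (.comp (a'.map f') Λ')
  | src_comp {Z : GSet.{u} n} (γ : GMap Z (freeGSet (one n)))
      (f : ∀ {j : ℕ} {hj : j ≤ n}, Z.cell j hj → OExpr n j hj)
      (hf : ∀ {j : ℕ} {hj : j ≤ n} (z : Z.cell j hj), Rel (γ.app z) (f z) (f z))
      (hs : ∀ {j : ℕ} {hj : j + 1 ≤ n} (z : Z.cell (j + 1) hj),
        Rel (γ.app (Z.src z)) (f (Z.src z)) (f z).src)
      (ht : ∀ {j : ℕ} {hj : j + 1 ≤ n} (z : Z.cell (j + 1) hj),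
        Rel (γ.app (Z.tgt z)) (f (Z.tgt z)) (f z).tgt)
      {k : ℕ} {h : k + 1 ≤ n} {p : FreeCell Z (k + 1) h} {a : PExpr Z.cell (k + 1) h}
      {b : PExpr Z.cell k (Nat.le_of_succ_le h)} (ha : a.Denotes Z p) (hb : b.Denotes Z p.src)
      {Λ : OExpr n (k + 1) h} (hΛ : Rel ((freeMap (bang Z)).app p) Λ Λ) :
      Rel ((multMap (one n)).app ((freeMap γ).app p.src))
        (OExpr.comp (a.map f) Λ).src (.comp (b.map f) Λ.src)
  | tgt_comp {Z : GSet.{u} n} (γ : GMap Z (freeGSet (one n)))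
      (f : ∀ {j : ℕ} {hj : j ≤ n}, Z.cell j hj → OExpr n j hj)
      (hf : ∀ {j : ℕ} {hj : j ≤ n} (z : Z.cell j hj), Rel (γ.app z) (f z) (f z))
      (hs : ∀ {j : ℕ} {hj : j + 1 ≤ n} (z : Z.cell (j + 1) hj),
        Rel (γ.app (Z.src z)) (f (Z.src z)) (f z).src)
      (ht : ∀ {j : ℕ} {hj : j + 1 ≤ n} (z : Z.cell (j + 1) hj),
        Rel (γ.app (Z.tgt z)) (f (Z.tgt z)) (f z).tgt)
      {k : ℕ} {h : k + 1 ≤ n} {p : FreeCell Z (k + 1) h} {a : PExpr Z.cell (k + 1) h}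
      {b : PExpr Z.cell k (Nat.le_of_succ_le h)} (ha : a.Denotes Z p) (hb : b.Denotes Z p.tgt)
      {Λ : OExpr n (k + 1) h} (hΛ : Rel ((freeMap (bang Z)).app p) Λ Λ) :
      Rel ((multMap (one n)).app ((freeMap γ).app p.tgt))
        (OExpr.comp (a.map f) Λ).tgt (.comp (b.map f) Λ.tgt)
  /- the axioms of an operad -/
  | ids_comp {k : ℕ} {h : k ≤ n} {τ : FreeCell (one n) k h} {Λ : OExpr n k h}
      {a : PExpr (one.{u} n).cell k h} (ha : a.Denotes (one n) τ) (hΛ : Rel τ Λ Λ) :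
      Rel τ (.comp (a.map fun _ => .ident) Λ) Λ
  | comp_ids {k : ℕ} {h : k ≤ n} {τ : FreeCell (one n) k h} {Λ : OExpr n k h} (hΛ : Rel τ Λ Λ) :
      Rel τ (.comp (.gen Λ) .ident) Λ
  | assoc {Y Z : GSet.{u} n} (γ : GMap Y (freeGSet (one n)))
      (f : ∀ {j : ℕ} {hj : j ≤ n}, Y.cell j hj → OExpr n j hj)
      (hf : ∀ {j : ℕ} {hj : j ≤ n} (y : Y.cell j hj), Rel (γ.app y) (f y) (f y))
      (hs : ∀ {j : ℕ} {hj : j + 1 ≤ n} (y : Y.cell (j + 1) hj),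
        Rel (γ.app (Y.src y)) (f (Y.src y)) (f y).src)
      (ht : ∀ {j : ℕ} {hj : j + 1 ≤ n} (y : Y.cell (j + 1) hj),
        Rel (γ.app (Y.tgt y)) (f (Y.tgt y)) (f y).tgt)
      (δ : GMap Z (freeGSet (one n)))
      (g : ∀ {j : ℕ} {hj : j ≤ n}, Z.cell j hj → OExpr n j hj)
      (hg : ∀ {j : ℕ} {hj : j ≤ n} (z : Z.cell j hj), Rel (δ.app z) (g z) (g z))
      (hs' : ∀ {j : ℕ} {hj : j + 1 ≤ n} (z : Z.cell (j + 1) hj),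
        Rel (δ.app (Z.src z)) (g (Z.src z)) (g z).src)
      (ht' : ∀ {j : ℕ} {hj : j + 1 ≤ n} (z : Z.cell (j + 1) hj),
        Rel (δ.app (Z.tgt z)) (g (Z.tgt z)) (g z).tgt)
      (q : GMap Z (freeGSet Y))
      (hq : ∀ {j : ℕ} {hj : j ≤ n} (z : Z.cell j hj),
        (freeMap (bang Y)).app (q.app z) = δ.app z)
      (b : ∀ {j : ℕ} {hj : j ≤ n}, Z.cell j hj → PExpr Y.cell j hj)
      (hb : ∀ {j : ℕ} {hj : j ≤ n} (z : Z.cell j hj), (b z).Denotes Y (q.app z))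
      {k : ℕ} {h : k ≤ n} {p : FreeCell Z k h} {a : PExpr Z.cell k h} {c : PExpr Y.cell k h}
      (ha : a.Denotes Z p) (hc : c.Denotes Y ((multMap Y).app ((freeMap q).app p)))
      {Λ : OExpr n k h} (hΛ : Rel ((freeMap (bang Z)).app p) Λ Λ) :
      Rel ((multMap (one n)).app ((freeMap γ).app ((multMap Y).app ((freeMap q).app p))))
        (.comp (a.map fun z => .comp ((b z).map f) (g z)) Λ)
        (.comp (c.map f) (.comp (a.map g) Λ))
  /- in dimension `n`, parallel cells of the same shape are equal -/
  | top_zero {h : 0 ≤ n} (hn : n = 0) {τ : FreeCell (one n) 0 h} {x x' : OExpr n 0 h} :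
      Rel τ x x → Rel τ x' x' → Rel τ x x'
  | top_succ {k : ℕ} {h : k + 1 ≤ n} (hn : n = k + 1) {τ : FreeCell (one n) (k + 1) h}
      {x x' : OExpr n (k + 1) h} : Rel τ x x → Rel τ x' x' →
      Rel (bdry τ) x.src x'.src → Rel (bdry τ) x.tgt x'.tgt → Rel τ x x'

theorem OExpr.Rel.left {k : ℕ} {h : k ≤ n} {τ : FreeCell (one.{u} n) k h} {a b : OExpr n k h}
    (H : Rel τ a b) : Rel τ a a := H.trans H.symm

/-- Two well formed expressions of shape `τ` are identified if they denote the same cell. -/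
def initSetoid {k : ℕ} {h : k ≤ n} (τ : FreeCell (one.{u} n) k h) :
    Setoid {a : OExpr.{u} n k h // OExpr.Rel τ a a} where
  r a b := OExpr.Rel τ a.1 b.1
  iseqv := ⟨fun a => a.2, fun H => H.symm, fun H H' => H.trans H'⟩

/-- The `k`-cells of `I_n`, with their shapes. -/
def InitCell (k : ℕ) (h : k ≤ n) : Type u :=
  Σ τ : FreeCell (one.{u} n) k h, Quotient (initSetoid τ)

/-- The cell denoted by an expression of shape `τ`. -/
def InitCell.mk {k : ℕ} {h : k ≤ n} {τ : FreeCell (one.{u} n) k h} {a : OExpr.{u} n k h}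
    (H : OExpr.Rel τ a a) : InitCell.{u} k h := ⟨τ, Quotient.mk _ ⟨a, H⟩⟩

theorem InitCell.mk_eq {k : ℕ} {h : k ≤ n} {τ σ : FreeCell (one.{u} n) k h} {a b : OExpr.{u} n k h}
    {Ha : OExpr.Rel τ a a} {Hb : OExpr.Rel σ b b} (e : τ = σ) (H : OExpr.Rel τ a b) :
    InitCell.mk Ha = InitCell.mk Hb := by
  subst e
  exact congrArg (Sigma.mk τ) (Quotient.sound H)

theorem InitCell.exact {k : ℕ} {h : k ≤ n} {τ σ : FreeCell (one.{u} n) k h} {a b : OExpr.{u} n k h}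
    {Ha : OExpr.Rel τ a a} {Hb : OExpr.Rel σ b b} (H : InitCell.mk Ha = InitCell.mk Hb) :
    OExpr.Rel τ a b := by
  obtain rfl : τ = σ := congrArg Sigma.fst H
  exact Quotient.exact (eq_of_heq (Sigma.mk.inj H).2)

theorem InitCell.exists_rep {k : ℕ} {h : k ≤ n} (x : InitCell.{u} k h) :
    ∃ (a : OExpr.{u} n k h) (H : OExpr.Rel x.1 a a), InitCell.mk H = x := by
  obtain ⟨τ, q⟩ := x
  induction q using Quotient.inductionOn with
  | h a => exact ⟨a.1, a.2, rfl⟩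

/-- A chosen expression for a cell. -/
noncomputable def InitCell.rep {k : ℕ} {h : k ≤ n} (x : InitCell.{u} k h) : OExpr.{u} n k h :=
  x.exists_rep.choose

theorem InitCell.rep_rel {k : ℕ} {h : k ≤ n} (x : InitCell.{u} k h) :
    OExpr.Rel x.1 x.rep x.rep := x.exists_rep.choose_spec.choose

theorem InitCell.mk_rep {k : ℕ} {h : k ≤ n} (x : InitCell.{u} k h) :
    InitCell.mk x.rep_rel = x := x.exists_rep.choose_spec.choose_spec

theorem InitCell.rel_rep {k : ℕ} {h : k ≤ n} {τ : FreeCell (one.{u} n) k h} {a : OExpr.{u} n k h}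
    (H : OExpr.Rel τ a a) : OExpr.Rel τ (InitCell.mk H).rep a :=
  InitCell.exact (InitCell.mk_rep (InitCell.mk H))

/-- The source of a cell of `I_n`. -/
noncomputable def InitCell.src {k : ℕ} {h : k + 1 ≤ n} (x : InitCell.{u} (k + 1) h) :
    InitCell.{u} k (Nat.le_of_succ_le h) := InitCell.mk x.rep_rel.src_congr

/-- The target of a cell of `I_n`. -/
noncomputable def InitCell.tgt {k : ℕ} {h : k + 1 ≤ n} (x : InitCell.{u} (k + 1) h) :
    InitCell.{u} k (Nat.le_of_succ_le h) := InitCell.mk x.rep_rel.tgt_congr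

theorem InitCell.src_mk {k : ℕ} {h : k + 1 ≤ n} {τ : FreeCell (one.{u} n) (k + 1) h}
    {a : OExpr.{u} n (k + 1) h} (H : OExpr.Rel τ a a) :
    (InitCell.mk H).src = InitCell.mk H.src_congr :=
  InitCell.mk_eq rfl (InitCell.rel_rep H).src_congr

theorem InitCell.tgt_mk {k : ℕ} {h : k + 1 ≤ n} {τ : FreeCell (one.{u} n) (k + 1) h}
    {a : OExpr.{u} n (k + 1) h} (H : OExpr.Rel τ a a) :
    (InitCell.mk H).tgt = InitCell.mk H.tgt_congr :=
  InitCell.mk_eq rfl (InitCell.rel_rep H).tgt_congr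

theorem InitCell.rep_src {k : ℕ} {h : k + 1 ≤ n} (x : InitCell.{u} (k + 1) h) :
    OExpr.Rel x.src.1 x.src.rep x.rep.src := InitCell.rel_rep x.rep_rel.src_congr

theorem InitCell.rep_tgt {k : ℕ} {h : k + 1 ≤ n} (x : InitCell.{u} (k + 1) h) :
    OExpr.Rel x.tgt.1 x.tgt.rep x.rep.tgt := InitCell.rel_rep x.rep_rel.tgt_congr

/-- The collection underlying `I_n`. -/
noncomputable def initColl (n : ℕ) : GColl.{u} n where
  cell k h := InitCell.{u} k h
  src := InitCell.src
  tgt := InitCell.tgt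
  src_src x := by
    obtain ⟨a, H, e⟩ := x.exists_rep
    rw [← e, InitCell.src_mk, InitCell.tgt_mk, InitCell.src_mk, InitCell.src_mk]
    exact InitCell.mk_eq ((freeGSet (one n)).src_src x.1) H.src_src
  tgt_tgt x := by
    obtain ⟨a, H, e⟩ := x.exists_rep
    rw [← e, InitCell.src_mk, InitCell.tgt_mk, InitCell.tgt_mk, InitCell.tgt_mk]
    refine InitCell.mk_eq ((freeGSet (one n)).tgt_tgt x.1) ?_
    have := H.tgt_tgt
    rwa [show FreeCell.tgt (FreeCell.tgt x.1) = FreeCell.tgt (FreeCell.src x.1) from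
      ((freeGSet (one n)).tgt_tgt x.1).symm] at this
  shape := { app := fun x => x.1, map_src := fun _ => rfl, map_tgt := fun _ => rfl }

theorem gen_src {k : ℕ} {h : k + 1 ≤ n} :
    (FreeCell.gen (X := one.{u} n) (h := h) PUnit.unit).src = FreeCell.gen PUnit.unit :=
  ((unitMap (one n)).map_src PUnit.unit).symm

theorem gen_tgt {k : ℕ} {h : k + 1 ≤ n} :
    (FreeCell.gen (X := one.{u} n) (h := h) PUnit.unit).tgt = FreeCell.gen PUnit.unit :=
  ((unitMap (one n)).map_tgt PUnit.unit).symm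

/-- The identity cells of `I_n`. -/
noncomputable def initIds (n : ℕ) : CollHom (unitColl.{u} n) (initColl.{u} n) where
  app _ := InitCell.mk .ident
  map_src _ := ((InitCell.src_mk _).trans
    (InitCell.mk_eq gen_src (by rw [gen_src]; exact OExpr.Rel.src_ident))).symm
  map_tgt _ := ((InitCell.tgt_mk _).trans
    (InitCell.mk_eq gen_tgt (by rw [gen_tgt]; exact OExpr.Rel.tgt_ident))).symm
  map_shape _ := rfl

/-- An expression for the composite of a cell with a pasting diagram of cells. -/
noncomputable def compRep {k : ℕ} {h : k ≤ n}
    (x : (tensor (initColl.{u} n) (initColl.{u} n)).cell k h) : OExpr.{u} n k h :=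
  .comp ((exists_denotes x.1.1).choose.map fun z => InitCell.rep z) (InitCell.rep x.1.2)

theorem shape_rel {k : ℕ} {h : k ≤ n} (x : (tensor (initColl.{u} n) (initColl.{u} n)).cell k h) :
    OExpr.Rel ((freeMap (bang (initColl.{u} n).toGSet)).app x.1.1) (InitCell.rep x.1.2)
      (InitCell.rep x.1.2) := by
  rw [x.2]
  exact InitCell.rep_rel x.1.2

theorem compRep_rel {k : ℕ} {h : k ≤ n}
    (x : (tensor (initColl.{u} n) (initColl.{u} n)).cell k h) {b : PExpr InitCell.{u} k h}
    (hb : b.Denotes (initColl.{u} n).toGSet x.1.1) {Λ : OExpr.{u} n k h}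
    (hΛ : OExpr.Rel x.1.2.1 (InitCell.rep x.1.2) Λ) :
    OExpr.Rel ((tensor (initColl.{u} n) (initColl.{u} n)).shape.app x) (compRep x)
      (.comp (b.map fun z => InitCell.rep z) Λ) :=
  OExpr.Rel.comp_congr (Z := (initColl n).toGSet) (initColl n).shape _ _
    (fun z => InitCell.rep_rel z) (fun z => InitCell.rep_src z) (fun z => InitCell.rep_tgt z)
    (exists_denotes x.1.1).choose_spec hb (by rw [x.2]; exact hΛ)

theorem compRep_self {k : ℕ} {h : k ≤ n}
    (x : (tensor (initColl.{u} n) (initColl.{u} n)).cell k h) :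
    OExpr.Rel ((tensor (initColl.{u} n) (initColl.{u} n)).shape.app x) (compRep x) (compRep x) :=
  compRep_rel x (exists_denotes x.1.1).choose_spec (InitCell.rep_rel x.1.2)

theorem compRep_src {k : ℕ} {h : k + 1 ≤ n}
    (x : (tensor (initColl.{u} n) (initColl.{u} n)).cell (k + 1) h) :
    OExpr.Rel ((tensor (initColl.{u} n) (initColl.{u} n)).shape.app
      ((tensor (initColl.{u} n) (initColl.{u} n)).src x))
      (compRep ((tensor (initColl.{u} n) (initColl.{u} n)).src x)) (compRep x).src := by
  obtain ⟨b, hb⟩ := exists_denotes (FreeCell.src x.1.1)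
  refine OExpr.Rel.trans (compRep_rel ((tensor (initColl.{u} n) (initColl.{u} n)).src x) hb
    (InitCell.rep_src x.1.2)) (OExpr.Rel.symm ?_)
  exact OExpr.Rel.src_comp (Z := (initColl n).toGSet) (initColl n).shape _
    (fun z => InitCell.rep_rel z) (fun z => InitCell.rep_src z) (fun z => InitCell.rep_tgt z)
    (exists_denotes x.1.1).choose_spec hb (shape_rel x)

theorem compRep_tgt {k : ℕ} {h : k + 1 ≤ n}
    (x : (tensor (initColl.{u} n) (initColl.{u} n)).cell (k + 1) h) :
    OExpr.Rel ((tensor (initColl.{u} n) (initColl.{u} n)).shape.app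
      ((tensor (initColl.{u} n) (initColl.{u} n)).tgt x))
      (compRep ((tensor (initColl.{u} n) (initColl.{u} n)).tgt x)) (compRep x).tgt := by
  obtain ⟨b, hb⟩ := exists_denotes (FreeCell.tgt x.1.1)
  refine OExpr.Rel.trans (compRep_rel ((tensor (initColl.{u} n) (initColl.{u} n)).tgt x) hb
    (InitCell.rep_tgt x.1.2)) (OExpr.Rel.symm ?_)
  exact OExpr.Rel.tgt_comp (Z := (initColl n).toGSet) (initColl n).shape _
    (fun z => InitCell.rep_rel z) (fun z => InitCell.rep_src z) (fun z => InitCell.rep_tgt z)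
    (exists_denotes x.1.1).choose_spec hb (shape_rel x)

/-- The composition of `I_n`. -/
noncomputable def initComp (n : ℕ) :
    CollHom (tensor (initColl.{u} n) (initColl.{u} n)) (initColl.{u} n) where
  app x := InitCell.mk (compRep_self x)
  map_src x := ((InitCell.src_mk _).trans
    ((InitCell.mk_eq ((tensor (initColl.{u} n) (initColl.{u} n)).shape.map_src x)
      (compRep_src x)).symm)).symm
  map_tgt x := ((InitCell.tgt_mk _).trans
    ((InitCell.mk_eq ((tensor (initColl.{u} n) (initColl.{u} n)).shape.map_tgt x)
      (compRep_tgt x)).symm)).symm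
  map_shape _ := rfl

theorem PExpr.eval_bind {X Y : (k : ℕ) → k ≤ n → Type u} (C : NCat.{u} n)
    (f : ∀ {k : ℕ} {h : k ≤ n}, Y k h → C.cell k h)
    (g : ∀ {k : ℕ} {h : k ≤ n}, X k h → Y k h) :
    ∀ {k : ℕ} {h : k ≤ n} (a : PExpr X k h), (a.map g).eval C f = a.eval C fun x => f (g x)
  | _, _, .gen _ => rfl
  | _, _, .idn a => congrArg (Option.map C.idn) (PExpr.eval_bind C f g a)
  | _, _, .comp c a b => by
    have e1 := PExpr.eval_bind C f g a
    have e2 := PExpr.eval_bind C f g b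
    change PExpr.eval C f (.comp c (a.map g) (b.map g)) = _
    simp only [PExpr.eval, e1, e2]

theorem PExpr.Denotes.map {X Y : GSet.{u} n} (f : GMap X Y) {k : ℕ} {h : k ≤ n}
    {a : PExpr X.cell k h} {p : FreeCell X k h} (H : a.Denotes X p) :
    (a.map f.app).Denotes Y ((freeMap f).app p) := by
  have key : ∀ (C : NCat.{u} n) (g : GMap Y C.toGSet),
      (a.map f.app).eval C g.app = some (evalFree C (g.comp f) p) := fun C g =>
    (PExpr.eval_bind C g.app f.app a).trans (eval_of_denotes C (g.comp f) H)
  refine ⟨fun C g => ⟨_, key C g⟩, evalFree_ext fun C g => ?_⟩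
  refine (evalFree_eq C g ⟨_, rfl⟩ (key C g)).trans ?_
  refine Eq.symm ((evalFree_functor _ (isNFunctor_evalMap C g) p).trans ?_)
  congr 1
  exact GMap.ext fun _ _ _ => evalFree_gen _ _ _

theorem PExpr.map_map {X Y Z : (k : ℕ) → k ≤ n → Type u}
    (f : ∀ {k : ℕ} {h : k ≤ n}, Y k h → Z k h)
    (g : ∀ {k : ℕ} {h : k ≤ n}, X k h → Y k h) :
    ∀ {k : ℕ} {h : k ≤ n} (a : PExpr X k h), (a.map g).map f = a.map fun x => f (g x)
  | _, _, .gen _ => rfl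
  | _, _, .idn a => congrArg PExpr.idn (PExpr.map_map f g a)
  | _, _, .comp c a b =>
    congrArg₂ (PExpr.comp c) (PExpr.map_map f g a) (PExpr.map_map f g b)

/-- The composite of a cell denoted by `Λ` with a labelled pasting diagram is denoted by the
corresponding formal composite. -/
theorem compRep_labels {k : ℕ} {h : k ≤ n}
    (x : (tensor (initColl.{u} n) (initColl.{u} n)).cell k h) {Z : GSet.{u} n}
    (γ : GMap Z (initColl.{u} n).toGSet) {p : FreeCell Z k h} (hp : (freeMap γ).app p = x.1.1)
    (f : ∀ {j : ℕ} {hj : j ≤ n}, Z.cell j hj → OExpr n j hj)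
    (hf : ∀ {j : ℕ} {hj : j ≤ n} (z : Z.cell j hj),
      OExpr.Rel (γ.app z).1 (InitCell.rep (γ.app z)) (f z))
    {a : PExpr Z.cell k h} (ha : a.Denotes Z p) {Λ : OExpr.{u} n k h}
    (hΛ : OExpr.Rel x.1.2.1 (InitCell.rep x.1.2) Λ) :
    OExpr.Rel ((tensor (initColl.{u} n) (initColl.{u} n)).shape.app x) (compRep x)
      (.comp (a.map f) Λ) := by
  have hb := ha.map γ
  rw [hp] at hb
  refine OExpr.Rel.trans (compRep_rel x hb hΛ) ?_
  have em : (PExpr.map γ.app a).map (fun z => InitCell.rep z) =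
      a.map fun z => InitCell.rep (γ.app z) := PExpr.map_map _ _ a
  refine em ▸ ?_
  have e : (tensor (initColl.{u} n) (initColl.{u} n)).shape.app x =
      (multMap (one n)).app ((freeMap ((initColl.{u} n).shape.comp γ)).app p) := by
    rw [← freeMap_freeMap, hp]
    rfl
  rw [e]
  refine OExpr.Rel.comp_congr ((initColl.{u} n).shape.comp γ) _ f hf (fun z => ?_) (fun z => ?_)
    ha ha ?_
  · have e := γ.map_src z
    change OExpr.Rel (γ.app (Z.src z)).1 (InitCell.rep (γ.app (Z.src z))) _
    rw [e]
    exact InitCell.rep_src _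
  · have e := γ.map_tgt z
    change OExpr.Rel (γ.app (Z.tgt z)).1 (InitCell.rep (γ.app (Z.tgt z))) _
    rw [e]
    exact InitCell.rep_tgt _
  · rw [← freeMap_bang γ, hp, x.2]
    exact hΛ.symm.left

theorem init_ids_comp {k : ℕ} {h : k ≤ n} (x : InitCell.{u} k h) :
    (initComp.{u} n).app ((tensorMap (initIds n) (CollHom.id _)).app
      ((leftUnit (initColl n)).app x)) = x := by
  obtain ⟨a, ha⟩ := exists_denotes (X := one.{u} n) x.1
  have e : (multMap (one n)).app ((freeMap (initColl n).shape).app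
      ((freeMap (initIds n).toGMap).app x.1)) = x.1 := by
    refine (congrArg (multMap (one n)).app
      (freeMap_freeMap (initColl n).shape (initIds n).toGMap x.1)).trans ?_
    exact multMap_freeMap_unitMap x.1
  have H := compRep_labels ((tensorMap (initIds n) (CollHom.id _)).app
      ((leftUnit (initColl n)).app x)) (initIds n).toGMap (p := x.1) rfl (fun _ => .ident)
    (fun _ => InitCell.rel_rep .ident) ha (Λ := x.rep) x.rep_rel
  refine Eq.trans (InitCell.mk_eq e (H.trans ?_)) (InitCell.mk_rep x)
  refine e.symm ▸ ?_
  exact OExpr.Rel.ids_comp ha x.rep_rel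

theorem init_comp_ids {k : ℕ} {h : k ≤ n} (x : InitCell.{u} k h) :
    (initComp.{u} n).app ((tensorMap (CollHom.id _) (initIds n)).app
      ((rightUnit (initColl n)).app x)) = x := by
  have e0 : (freeMap (GMap.id (initColl n).toGSet)).app (FreeCell.gen x) = FreeCell.gen x :=
    freeMap_id _
  have e : (multMap (one n)).app ((freeMap (initColl n).shape).app
      ((freeMap (GMap.id (initColl n).toGSet)).app (FreeCell.gen x))) = x.1 := by
    rw [e0]
    exact (congrArg (multMap (one n)).app (freeMap_gen (initColl n).shape x)).trans
      (multMap_gen x.1)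
  have hb : (PExpr.gen x).Denotes (initColl n).toGSet
      ((freeMap (GMap.id (initColl n).toGSet)).app (FreeCell.gen x)) := by
    rw [e0]
    exact FreeCell.gen_denotes (X := (initColl n).toGSet) x
  have H := compRep_rel ((tensorMap (CollHom.id _) (initIds n)).app
      ((rightUnit (initColl n)).app x)) hb (InitCell.rel_rep .ident)
  refine Eq.trans (InitCell.mk_eq e (H.trans ?_)) (InitCell.mk_rep x)
  refine e.symm ▸ ?_
  exact OExpr.Rel.comp_ids x.rep_rel

theorem init_assoc {k : ℕ} {h : k ≤ n}
    (x : (tensor (tensor (initColl.{u} n) (initColl n)) (initColl n)).cell k h) :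
    (initComp.{u} n).app ((tensorMap (initComp n) (CollHom.id _)).app x) =
      (initComp n).app ((tensorMap (CollHom.id _) (initComp n)).app
        ((assocMap (initColl n) (initColl n) (initColl n)).app x)) := by
  obtain ⟨a, ha⟩ := exists_denotes x.1.1
  obtain ⟨c, hc⟩ := exists_denotes ((multMap (initColl n).toGSet).app
    ((freeMap (tensorFst (initColl n) (initColl n))).app x.1.1))
  have e0 := freeMap_id ((multMap (initColl n).toGSet).app
    ((freeMap (tensorFst (initColl n) (initColl n))).app x.1.1))
  have hc' := hc
  rw [← e0] at hc'
  have H1 := compRep_labels ((tensorMap (initComp n) (CollHom.id _)).app x) (initComp n).toGMap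
    (p := x.1.1) rfl (fun z => compRep z) (fun z => InitCell.rel_rep (compRep_self z)) ha
    (InitCell.rep_rel x.1.2)
  have H2 := compRep_rel ((tensorMap (CollHom.id _) (initComp n)).app
    ((assocMap (initColl n) (initColl n) (initColl n)).app x)) hc'
    ((InitCell.rel_rep (compRep_self _)).trans
      (compRep_labels _ (tensorSnd (initColl n) (initColl n)) (p := x.1.1) rfl
        (fun z => InitCell.rep z.1.2) (fun z => InitCell.rep_rel z.1.2) ha
        (InitCell.rep_rel x.1.2)))
  have H3 := OExpr.Rel.assoc (Y := (initColl n).toGSet)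
    (Z := (tensor (initColl n) (initColl n)).toGSet) (initColl n).shape _
    (fun z => InitCell.rep_rel z) (fun z => InitCell.rep_src z) (fun z => InitCell.rep_tgt z)
    ((initColl n).shape.comp (tensorSnd (initColl n) (initColl n)))
    (fun z => InitCell.rep z.1.2) (fun z => InitCell.rep_rel z.1.2)
    (fun z => InitCell.rep_src z.1.2) (fun z => InitCell.rep_tgt z.1.2)
    (tensorFst (initColl n) (initColl n)) (fun z => z.2) (fun z => (exists_denotes z.1.1).choose)
    (fun z => (exists_denotes z.1.1).choose_spec) ha hc (Λ := InitCell.rep x.1.2) (by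
      rw [show (freeMap (bang (tensor (initColl n) (initColl n)).toGSet)).app x.1.1 = _ from x.2]
      exact InitCell.rep_rel x.1.2)
  have e2 : (tensor (initColl.{u} n) (initColl n)).shape.app
        ((tensorMap (CollHom.id _) (initComp n)).app
          ((assocMap (initColl n) (initColl n) (initColl n)).app x)) =
      (multMap (one n)).app ((freeMap (initColl n).shape).app
        ((multMap (initColl n).toGSet).app
          ((freeMap (tensorFst (initColl n) (initColl n))).app x.1.1))) :=
    congrArg (multMap (one n)).app (congrArg (freeMap (initColl n).shape).app e0)
  have e1 : (tensor (initColl.{u} n) (initColl n)).shape.app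
      ((tensorMap (initComp n) (CollHom.id _)).app x) =
      (tensor (initColl.{u} n) (initColl n)).shape.app
        ((tensorMap (CollHom.id _) (initComp n)).app
          ((assocMap (initColl n) (initColl n) (initColl n)).app x)) := by
    refine (congrArg (multMap (one n)).app (freeMap_freeMap _ _ _)).trans (Eq.trans ?_ e2.symm)
    refine Eq.trans ?_ (congrArg (multMap (one n)).app (multMap_natural _ _)).symm
    refine Eq.trans (congrArg (multMap (one n)).app ?_) (multMap_multMap _).symm
    refine Eq.trans ?_ (congrArg (freeMap (multMap (one n))).app (freeMap_freeMap _ _ _)).symm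
    exact (freeMap_freeMap (multMap (one n))
      ((freeMap (initColl n).shape).comp (tensorFst (initColl n) (initColl n))) x.1.1).symm
  refine InitCell.mk_eq e1 (H1.trans (e1 ▸ OExpr.Rel.trans ?_ H2.symm))
  exact e2 ▸ H3

/-- The operad `I_n`. -/
noncomputable def initOperad (n : ℕ) : Operad.{u} n where
  toGColl := initColl n
  ids := initIds n
  comp := initComp n
  ids_comp x := init_ids_comp x
  comp_ids x := init_comp_ids x
  assoc x := init_assoc x

theorem contr_rel {k : ℕ} {h : k + 1 ≤ n} {x x' : InitCell.{u} k (Nat.le_of_succ_le h)}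
    {τ : FreeCell (one.{u} n) (k + 1) h} (A : (initColl.{u} n).Admissible x x' τ) :
    OExpr.Rel τ (.contr x.rep x'.rep τ) (.contr x.rep x'.rep τ) := by
  have e : x.1 = bdry τ := A.shape_left
  have e' : x'.1 = bdry τ := A.shape_right
  have H := e ▸ x.rep_rel
  have H' := e' ▸ x'.rep_rel
  cases k with
  | zero => exact .contr_zero H H'
  | succ k =>
    have P : x.src = x'.src ∧ x.tgt = x'.tgt := A.parallel
    have Hs : OExpr.Rel x.1.src x.rep.src x'.rep.src := InitCell.exact P.1
    have Ht : OExpr.Rel x.1.tgt x.rep.tgt x'.rep.tgt := InitCell.exact P.2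
    rw [← one_src_eq_tgt] at Ht
    exact .contr_succ H H' (e ▸ Hs) (e ▸ Ht)

/-- The canonical contraction of `I_n`, given by the contraction cells. -/
noncomputable def initContraction (n : ℕ) : Contraction (initColl.{u} n) where
  cell _ _ _ A := InitCell.mk (contr_rel A)
  src_cell x x' τ A := by
    refine (InitCell.src_mk _).trans (Eq.trans (InitCell.mk_eq ?_ ?_) (InitCell.mk_rep x))
    · exact A.shape_left.symm
    · exact (contr_rel A).src_contr
  tgt_cell x x' τ A := by
    refine (InitCell.tgt_mk _).trans (Eq.trans (InitCell.mk_eq ?_ ?_) (InitCell.mk_rep x'))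
    · exact (one_src_eq_tgt τ).symm.trans A.shape_right.symm
    · exact one_src_eq_tgt τ ▸ (contr_rel A).tgt_contr
  shape_cell _ _ _ _ := rfl

theorem initColl_topUnique (n : ℕ) : (initColl.{u} n).TopUnique := by
  intro x x' P e
  have e' : x.1 = x'.1 := e
  have H' : OExpr.Rel x.1 (InitCell.rep x') (InitCell.rep x') := e' ▸ InitCell.rep_rel x'
  refine (InitCell.mk_rep x).symm.trans (Eq.trans ?_ (InitCell.mk_rep x'))
  refine InitCell.mk_eq e' ?_
  cases n with
  | zero => exact .top_zero rfl (InitCell.rep_rel x) H'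
  | succ n =>
    have P' : InitCell.src x = InitCell.src x' ∧ InitCell.tgt x = InitCell.tgt x' := P
    have Ht : OExpr.Rel x.1.tgt (InitCell.rep x).tgt (InitCell.rep x').tgt := InitCell.exact P'.2
    rw [← one_src_eq_tgt] at Ht
    exact .top_succ rfl (InitCell.rep_rel x) H' (InitCell.exact P'.1) Ht

/-- The contractible operad `I_n` with its canonical contraction. Its cells are the formal
composites of identity cells and of one contraction cell for every admissible triple
`(x, x', τ)`, with no relations in dimensions below `n` except those that hold in every operad. -/
noncomputable def initialCGOp (n : ℕ) : CGOp.{u} n where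
  toOperad := initOperad n
  contraction := initContraction n
  topUnique := initColl_topUnique n

end Glob

namespace Glob

variable {n : ℕ}

-- The operad `I_n` is a term model: its cells are classes of formal expressions in identities,
-- contraction cells, operadic composites, sources and targets, modulo the relations derivable by
-- `OExpr.Rel`. Its initiality is the universal property of a presentation by generators and
-- relations, with two complications. An expression need not make sense, and whether it does depends
-- on derivable relations: a contraction cell needs parallel ends, and a composite needs labels that
-- fit together and a matching shape. Well-formedness and equality are therefore derived
-- simultaneously, well-formedness of `a` in shape `τ` being `OExpr.Rel τ a a`.
--
-- Existence. Every expression is evaluated in `G` by reading contraction cells through the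
-- contraction of `G` and composites through its multiplication. Evaluation is a partial function
-- `OExpr.val` on all expressions. Soundness, `OExpr.Rel.sameVal`, is proved by induction on
-- derivations: related expressions both have a value, it is the same, and it has the indicated
-- shape. The three claims need each other, since equality of values makes cells parallel and
-- composable, and shapes decide whether a composite is defined. Each rule becomes an axiom of `G`:
-- the rules for composites reduce through `OExpr.val_comp` to statements about pasting diagrams
-- labelled by cells of `G`, associativity to `Operad.comp_labelled_assoc`, and the rules in
-- dimension `n` to the uniqueness of parallel `n`-cells of a given shape. Hence values descend to
-- classes and give `initDesc`, whose compatibility with all structure is a computation on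
-- representatives by `InitCell.val_mk`.
--
-- Uniqueness. The cells of `I_n` are generated from identities by contraction and composition,
-- operations that morphisms preserve, so two morphisms agree (`OExpr.Rel.agree`). The induction
-- again runs over derivations rather than expressions, because it is the premises of a rule that
-- say that the constituents of an expression are well formed. The inductive steps are `Agree.contr`
-- and `Agree.comp`, which identify a formal contraction cell or composite with the value of the
-- corresponding operation of `I_n`.

/-- The dimension is a variable `k` with an equation `n = k`, since the rules for the top dimension
speak of dimensions `0` and `k + 1` and not literally of `n`. -/
theorem GColl.TopUnique.eq_of_parallel {G : GColl.{u} n} (T : G.TopUnique) :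
    ∀ {k : ℕ} {h : k ≤ n}, n = k → ∀ {x x' : G.cell k h}, G.Parallel x x' →
      G.shape.app x = G.shape.app x' → x = x'
  | _, _, rfl, _, _, P, e => T _ _ P e

-- Partial evaluation of expressions in an operad with contraction

open Classical in
mutual

/-- The value of a formal composite of identity cells and contraction cells in an operad with
contraction; it is `none` if the expression is not well formed in the operad. -/
noncomputable def OExpr.val (G : CGOp.{u} n) :
    {k : ℕ} → {h : k ≤ n} → OExpr.{u} n k h → Option (G.cell k h)
  | _, _, .ident => some (G.ids.app PUnit.unit)
  | _, _, .contr x x' τ => (OExpr.val G x).bind fun v => (OExpr.val G x').bind fun v' =>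
      if A : G.Admissible v v' τ then some (G.contraction.cell v v' τ A) else none
  | _, _, .comp P Λ => (OExpr.pastingVal G P).bind fun p => (OExpr.val G Λ).bind fun w =>
      if e : (freeMap (bang G.toGSet)).app p = G.shape.app w then
        some (G.comp.app ⟨(p, w), e⟩) else none
  | _, _, .src a => (OExpr.val G a).map fun v => G.src v
  | _, _, .tgt a => (OExpr.val G a).map fun v => G.tgt v

/-- The pasting diagram obtained from a formal composite of expressions by evaluating these. -/
noncomputable def OExpr.pastingVal (G : CGOp.{u} n) :
    {k : ℕ} → {h : k ≤ n} → PExpr (OExpr.{u} n) k h → Option (FreeCell G.toGSet k h)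
  | _, _, .gen x => (OExpr.val G x).map fun v => FreeCell.gen v
  | _, _, .idn a => (OExpr.pastingVal G a).map fun p => FreeCell.idn p
  | _, _, .comp c a b => (OExpr.pastingVal G a).bind fun p => (OExpr.pastingVal G b).bind fun q =>
      if m : (free G.toGSet).Meets (c + 1) p q then some ((free G.toGSet).comp c p q m) else none

end

variable {G : CGOp.{u} n}

/-- Quantifying over the cells `x` of `1` lets this serve as the hypothesis on labels in
`OExpr.val_comp` for the labelling of `1` by identity cells. -/
theorem OExpr.val_ident {k : ℕ} {h : k ≤ n} (x : (unitColl.{u} n).cell k h) :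
    (OExpr.ident : OExpr.{u} n k h).val G = some (G.ids.app x) := by
  rw [OExpr.val]
  rfl

theorem OExpr.val_src {k : ℕ} {h : k + 1 ≤ n} {a : OExpr.{u} n (k + 1) h} {v : G.cell (k + 1) h}
    (e : a.val G = some v) : a.src.val G = some (G.src v) := by
  rw [OExpr.val, e]
  rfl

theorem OExpr.val_tgt {k : ℕ} {h : k + 1 ≤ n} {a : OExpr.{u} n (k + 1) h} {v : G.cell (k + 1) h}
    (e : a.val G = some v) : a.tgt.val G = some (G.tgt v) := by
  rw [OExpr.val, e]
  rfl

theorem OExpr.val_contr {k : ℕ} {h : k + 1 ≤ n} {x x' : OExpr.{u} n k (Nat.le_of_succ_le h)}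
    {v v' : G.cell k (Nat.le_of_succ_le h)} {τ : FreeCell (one.{u} n) (k + 1) h}
    (e : x.val G = some v) (e' : x'.val G = some v') (A : G.Admissible v v' τ) :
    (OExpr.contr x x' τ).val G = some (G.contraction.cell v v' τ A) := by
  rw [OExpr.val, e, e']
  exact dif_pos A

/-- Inversion of evaluation: only admissible triples of values produce a value, so the ends of the
resulting cell can be read off. -/
theorem OExpr.val_contr_eq_some {k : ℕ} {h : k + 1 ≤ n}
    {x x' : OExpr.{u} n k (Nat.le_of_succ_le h)} {τ : FreeCell (one.{u} n) (k + 1) h}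
    {c : G.cell (k + 1) h} (e : (OExpr.contr x x' τ).val G = some c) :
    ∃ (v v' : G.cell k (Nat.le_of_succ_le h)) (A : G.Admissible v v' τ),
      x.val G = some v ∧ x'.val G = some v' ∧ c = G.contraction.cell v v' τ A := by
  simp only [OExpr.val, Option.bind_eq_some_iff] at e
  obtain ⟨v, ev, v', ev', e⟩ := e
  by_cases A : G.Admissible v v' τ
  · rw [dif_pos A] at e
    exact ⟨v, v', A, ev, ev', (Option.some.inj e).symm⟩
  · rw [dif_neg A] at e
    cases e

-- Pasting diagrams labelled by cells of an operad

/-- The cell of `G ∘ G` given by a pasting diagram `p` in `Z`, a labelling of the cells of `Z` by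
cells of `G`, and a cell of `G` whose shape is that of `p`. -/
noncomputable def labelled {G : GColl.{u} n} {Z : GSet.{u} n} (φ : GMap Z G.toGSet) {k : ℕ}
    {h : k ≤ n} (p : FreeCell Z k h) (w : G.cell k h)
    (e : (freeMap (bang Z)).app p = G.shape.app w) : (tensor G G).cell k h :=
  ⟨((freeMap φ).app p, w), (freeMap_bang φ p).trans e⟩

theorem labelled_congr {G : GColl.{u} n} {Z : GSet.{u} n} {φ φ' : GMap Z G.toGSet}
    (E : ∀ {j : ℕ} {hj : j ≤ n} (z : Z.cell j hj), φ.app z = φ'.app z) {k : ℕ}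
    {h : k ≤ n} {p : FreeCell Z k h} {w w' : G.cell k h} (ew : w = w')
    (e : (freeMap (bang Z)).app p = G.shape.app w) :
    labelled φ p w e = labelled φ' p w' (ew ▸ e) := by
  obtain rfl : φ = φ' := GMap.ext fun _ _ => E
  subst ew
  rfl

theorem shape_labelled {G : GColl.{u} n} {Z : GSet.{u} n} (φ : GMap Z G.toGSet)
    {γ : GMap Z (freeGSet (one.{u} n))}
    (E : ∀ {j : ℕ} {hj : j ≤ n} (z : Z.cell j hj), G.shape.app (φ.app z) = γ.app z) {k : ℕ}
    {h : k ≤ n} {p : FreeCell Z k h} {w : G.cell k h}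
    (e : (freeMap (bang Z)).app p = G.shape.app w) :
    (tensor G G).shape.app (labelled φ p w e) =
      (multMap (one n)).app ((freeMap γ).app p) := by
  obtain rfl : G.shape.comp φ = γ := GMap.ext fun _ _ => E
  exact congrArg (multMap (one n)).app (freeMap_freeMap G.shape φ p)

theorem tensorMap_labelled {G H : GColl.{u} n} (F : CollHom G H) {Z : GSet.{u} n}
    (φ : GMap Z G.toGSet) {k : ℕ} {h : k ≤ n} {p : FreeCell Z k h} {w : G.cell k h}
    (e : (freeMap (bang Z)).app p = G.shape.app w) :
    (tensorMap F F).app (labelled φ p w e) =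
      labelled (F.toGMap.comp φ) p (F.app w) (e.trans (F.map_shape w).symm) :=
  Subtype.ext (Prod.ext (freeMap_freeMap F.toGMap φ p) rfl)

/-- The recursion defining `OExpr.pastingVal` is evaluation in the free strict `n`-category on `G`,
with the labels evaluated along the way. Once it is expressed by `PExpr.eval`, the result depends
only on the pasting diagram denoted by `a`. -/
theorem OExpr.pastingVal_map {Z : GSet.{u} n}
    {f : ∀ {j : ℕ} {hj : j ≤ n}, Z.cell j hj → OExpr.{u} n j hj} (φ : GMap Z G.toGSet)
    (E : ∀ {j : ℕ} {hj : j ≤ n} (z : Z.cell j hj), (f z).val G = some (φ.app z)) :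
    ∀ {k : ℕ} {h : k ≤ n} (a : PExpr Z.cell k h),
      OExpr.pastingVal G (a.map f) =
        a.eval (free G.toGSet) ((unitMap G.toGSet).comp φ).app
  | _, _, .gen z => by
      change OExpr.pastingVal G (.gen (f z)) = _
      rw [OExpr.pastingVal, E z]
      rfl
  | _, _, .idn a => by
      change OExpr.pastingVal G (.idn (a.map f)) = _
      rw [OExpr.pastingVal, OExpr.pastingVal_map φ E a]
      rfl
  | _, _, .comp c a b => by
      change OExpr.pastingVal G (.comp c (a.map f) (b.map f)) = _
      rw [OExpr.pastingVal, OExpr.pastingVal_map φ E a, OExpr.pastingVal_map φ E b]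
      rfl

/-- The pasting part evaluates to `φ^*(p)`, and relabelling along `φ` does not change the image
under `!^*`, so the composability test in `OExpr.val` reduces to `e`. The value involves `a` only
through `p`; this makes the choice of an expression for a pasting diagram harmless. -/
theorem OExpr.val_comp {Z : GSet.{u} n}
    {f : ∀ {j : ℕ} {hj : j ≤ n}, Z.cell j hj → OExpr.{u} n j hj} (φ : GMap Z G.toGSet)
    (E : ∀ {j : ℕ} {hj : j ≤ n} (z : Z.cell j hj), (f z).val G = some (φ.app z))
    {k : ℕ} {h : k ≤ n} {p : FreeCell Z k h} {a : PExpr Z.cell k h} (ha : a.Denotes Z p)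
    {Λ : OExpr n k h} {w : G.cell k h} (hΛ : Λ.val G = some w)
    (e : (freeMap (bang Z)).app p = G.shape.app w) :
    (OExpr.comp (a.map f) Λ).val G = some (G.comp.app (labelled φ p w e)) := by
  have H : OExpr.pastingVal G (a.map f) = some ((freeMap φ).app p) :=
    (OExpr.pastingVal_map φ E a).trans
      (eval_of_denotes (free G.toGSet) ((unitMap G.toGSet).comp φ) ha)
  rw [OExpr.val, H, hΛ]
  exact dif_pos ((freeMap_bang φ p).trans e)

-- Soundness of the relations

/-- `a` and `b` have the same value in `G`, a cell of shape `τ`. -/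
def OExpr.SameVal (G : CGOp.{u} n) {k : ℕ} {h : k ≤ n} (τ : FreeCell (one.{u} n) k h)
    (a b : OExpr.{u} n k h) : Prop :=
  ∃ v : G.cell k h, a.val G = some v ∧ b.val G = some v ∧ G.shape.app v = τ

/-- A labelling of the cells of a globular set by expressions whose values are compatible with
sources and targets amounts to a labelling by cells of the operad. -/
theorem OExpr.exists_labelling {Z : GSet.{u} n} {γ : GMap Z (freeGSet (one.{u} n))}
    {f f' : ∀ {j : ℕ} {hj : j ≤ n}, Z.cell j hj → OExpr.{u} n j hj}
    (hf : ∀ {j : ℕ} {hj : j ≤ n} (z : Z.cell j hj), OExpr.SameVal G (γ.app z) (f z) (f' z))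
    (hs : ∀ {j : ℕ} {hj : j + 1 ≤ n} (z : Z.cell (j + 1) hj),
      OExpr.SameVal G (γ.app (Z.src z)) (f (Z.src z)) (f z).src)
    (ht : ∀ {j : ℕ} {hj : j + 1 ≤ n} (z : Z.cell (j + 1) hj),
      OExpr.SameVal G (γ.app (Z.tgt z)) (f (Z.tgt z)) (f z).tgt) :
    ∃ φ : GMap Z G.toGSet,
      (∀ {j : ℕ} {hj : j ≤ n} (z : Z.cell j hj), (f z).val G = some (φ.app z)) ∧
      (∀ {j : ℕ} {hj : j ≤ n} (z : Z.cell j hj), (f' z).val G = some (φ.app z)) ∧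
      ∀ {j : ℕ} {hj : j ≤ n} (z : Z.cell j hj), G.shape.app (φ.app z) = γ.app z := by
  -- The labels are the values common to `f z` and `f' z`; an expression has at most one value, so
  -- `hs` and `ht` force compatibility with sources and targets.
  refine ⟨⟨fun z => (hf z).choose, fun z => ?_, fun z => ?_⟩, fun z => (hf z).choose_spec.1,
    fun z => (hf z).choose_spec.2.1, fun z => (hf z).choose_spec.2.2⟩
  · obtain ⟨v, e, e', -⟩ := hs z
    exact Option.some.inj ((hf (Z.src z)).choose_spec.1.symm.trans
      ((e.trans e'.symm).trans (OExpr.val_src (hf z).choose_spec.1)))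
  · obtain ⟨v, e, e', -⟩ := ht z
    exact Option.some.inj ((hf (Z.tgt z)).choose_spec.1.symm.trans
      ((e.trans e'.symm).trans (OExpr.val_tgt (hf z).choose_spec.1)))

/-- Sources in `G ∘ G` are taken componentwise, `φ^*` preserves them, and the multiplication is a
map of globular sets. -/
theorem Operad.comp_labelled_src (G : Operad.{u} n) {Z : GSet.{u} n} (φ : GMap Z G.toGSet) {k : ℕ}
    {h : k + 1 ≤ n} {p : FreeCell Z (k + 1) h} {w : G.cell (k + 1) h}
    (e : (freeMap (bang Z)).app p = G.shape.app w)
    (e' : (freeMap (bang Z)).app p.src = G.shape.app (G.src w)) :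
    G.comp.app (labelled φ p.src (G.src w) e') = G.src (G.comp.app (labelled φ p w e)) :=
  Eq.trans (congrArg G.comp.app (show labelled φ p.src (G.src w) e' =
      (tensor G.toGColl G.toGColl).src (labelled φ p w e) from
    Subtype.ext (Prod.ext ((freeMap φ).map_src p) rfl))) (G.comp.map_src _)

theorem Operad.comp_labelled_tgt (G : Operad.{u} n) {Z : GSet.{u} n} (φ : GMap Z G.toGSet) {k : ℕ}
    {h : k + 1 ≤ n} {p : FreeCell Z (k + 1) h} {w : G.cell (k + 1) h}
    (e : (freeMap (bang Z)).app p = G.shape.app w)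
    (e' : (freeMap (bang Z)).app p.tgt = G.shape.app (G.tgt w)) :
    G.comp.app (labelled φ p.tgt (G.tgt w) e') = G.tgt (G.comp.app (labelled φ p w e)) :=
  Eq.trans (congrArg G.comp.app (show labelled φ p.tgt (G.tgt w) e' =
      (tensor G.toGColl G.toGColl).tgt (labelled φ p w e) from
    Subtype.ext (Prod.ext ((freeMap φ).map_tgt p) rfl))) (G.comp.map_tgt _)

/-- The morphism `Z ⟶ G ∘ G` given by a morphism `q : Z ⟶ Y^*` and labellings of the cells of `Y`
and of `Z` by cells of `G`. -/
noncomputable def labelledMap {G : GColl.{u} n} {Y Z : GSet.{u} n} (φ : GMap Y G.toGSet)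
    (q : GMap Z (freeGSet Y)) (ψ : GMap Z G.toGSet)
    (hq : ∀ {j : ℕ} {hj : j ≤ n} (z : Z.cell j hj),
      (freeMap (bang Y)).app (q.app z) = G.shape.app (ψ.app z)) :
    GMap Z (tensor G G).toGSet where
  app z := labelled φ (q.app z) (ψ.app z) (hq z)
  map_src z := Subtype.ext (Prod.ext
    ((congrArg (freeMap φ).app (q.map_src z)).trans ((freeMap φ).map_src _)) (ψ.map_src z))
  map_tgt z := Subtype.ext (Prod.ext
    ((congrArg (freeMap φ).app (q.map_tgt z)).trans ((freeMap φ).map_tgt _)) (ψ.map_tgt z))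

/-- The associativity axiom of an operad for labelled pasting diagrams. -/
theorem Operad.comp_labelled_assoc (G : Operad.{u} n) {Y Z : GSet.{u} n} (φ : GMap Y G.toGSet)
    (ψ : GMap Z G.toGSet) (q : GMap Z (freeGSet Y))
    (hq : ∀ {j : ℕ} {hj : j ≤ n} (z : Z.cell j hj),
      (freeMap (bang Y)).app (q.app z) = G.shape.app (ψ.app z))
    {k : ℕ} {h : k ≤ n} {p : FreeCell Z k h} {w : G.cell k h}
    (e : (freeMap (bang Z)).app p = G.shape.app w)
    (e' : (freeMap (bang Y)).app ((multMap Y).app ((freeMap q).app p)) =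
      G.shape.app (G.comp.app (labelled ψ p w e))) :
    G.comp.app (labelled (G.comp.toGMap.comp (labelledMap φ q ψ hq)) p w e) =
      G.comp.app (labelled φ ((multMap Y).app ((freeMap q).app p))
        (G.comp.app (labelled ψ p w e)) e') := by
  -- Associativity is applied to the cell of `(G ∘ G) ∘ G` obtained from `p` by labelling its cells
  -- by cells of `G ∘ G`, paired with `w`.
  have H := G.assoc ⟨((freeMap (labelledMap φ q ψ hq)).app p, w), (freeMap_bang _ p).trans e⟩
  refine Eq.trans (congrArg G.comp.app ?_) (H.trans (congrArg G.comp.app ?_))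
  · exact Subtype.ext (Prod.ext (freeMap_freeMap G.comp.toGMap _ p).symm rfl)
  · refine Subtype.ext (Prod.ext ?_ (congrArg G.comp.app ?_))
    · refine (freeMap_id _).trans ?_
      -- Naturality of `μ` moves `φ^*` inside; both diagrams of diagrams are then images of `p`
      -- under the free functor applied to `φ^* ∘ q`.
      refine Eq.trans ?_ (multMap_natural φ _).symm
      refine congrArg (multMap G.toGSet).app ?_
      exact (freeMap_freeMap (tensorFst G.toGColl G.toGColl) _ p).trans
        (freeMap_freeMap (freeMap φ) q p).symm
    · refine Subtype.ext (Prod.ext ?_ rfl)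
      exact freeMap_freeMap (tensorSnd G.toGColl G.toGColl) _ p


/-- Related expressions have the same value in every operad with contraction. -/
theorem OExpr.Rel.sameVal {k : ℕ} {h : k ≤ n} {τ : FreeCell (one.{u} n) k h}
    {a b : OExpr.{u} n k h} (H : OExpr.Rel τ a b) : OExpr.SameVal G τ a b := by
  -- Every rule has the well-formedness of its ingredients among its premises, so the inductive
  -- hypotheses supply values for all of them, with the shapes needed to compose.
  induction H with
  | symm _ ih =>
    obtain ⟨v, ea, eb, s⟩ := ih
    exact ⟨v, eb, ea, s⟩
  | trans _ _ ih ih' =>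
    obtain ⟨v, ea, eb, s⟩ := ih
    obtain ⟨w, eb', ec, -⟩ := ih'
    obtain rfl : v = w := Option.some.inj (eb.symm.trans eb')
    exact ⟨v, ea, ec, s⟩
  | src_congr _ ih =>
    obtain ⟨v, ea, eb, rfl⟩ := ih
    exact ⟨_, OExpr.val_src ea, OExpr.val_src eb, G.shape.map_src v⟩
  | tgt_congr _ ih =>
    obtain ⟨v, ea, eb, rfl⟩ := ih
    exact ⟨_, OExpr.val_tgt ea, OExpr.val_tgt eb, G.shape.map_tgt v⟩
  | src_src _ ih =>
    obtain ⟨v, ea, -, rfl⟩ := ih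
    refine ⟨_, OExpr.val_src (OExpr.val_src ea), ?_, ?_⟩
    · rw [G.src_src]
      exact OExpr.val_src (OExpr.val_tgt ea)
    · exact (G.shape.map_src _).trans (congrArg FreeCell.src (G.shape.map_src v))
  | tgt_tgt _ ih =>
    obtain ⟨v, ea, -, rfl⟩ := ih
    refine ⟨_, ?_, OExpr.val_tgt (OExpr.val_tgt ea), ?_⟩
    · rw [← G.tgt_tgt]
      exact OExpr.val_tgt (OExpr.val_src ea)
    · exact (G.shape.map_tgt _).trans (congrArg FreeCell.tgt (G.shape.map_tgt v))
  | ident => exact ⟨_, OExpr.val_ident _, OExpr.val_ident _, G.ids.map_shape PUnit.unit⟩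
  | src_ident =>
    exact ⟨_, OExpr.val_src (OExpr.val_ident PUnit.unit),
      (OExpr.val_ident _).trans (congrArg some (G.ids.map_src PUnit.unit)),
      (congrArg G.shape.app (G.ids.map_src PUnit.unit).symm).trans (G.ids.map_shape PUnit.unit)⟩
  | tgt_ident =>
    exact ⟨_, OExpr.val_tgt (OExpr.val_ident PUnit.unit),
      (OExpr.val_ident _).trans (congrArg some (G.ids.map_tgt PUnit.unit)),
      (congrArg G.shape.app (G.ids.map_tgt PUnit.unit).symm).trans (G.ids.map_shape PUnit.unit)⟩
  | contr_zero _ _ ih ih' =>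
    obtain ⟨v, ex, ey, s⟩ := ih
    obtain ⟨v', ex', ey', s'⟩ := ih'
    have A : G.Admissible v v' _ := ⟨trivial, s, s'⟩
    exact ⟨_, OExpr.val_contr ex ex' A, OExpr.val_contr ey ey' A, G.contraction.shape_cell _ _ _ A⟩
  | contr_succ _ _ _ _ ih ih' ihs iht =>
    obtain ⟨v, ex, ey, s⟩ := ih
    obtain ⟨v', ex', ey', s'⟩ := ih'
    obtain ⟨_, es, es', -⟩ := ihs
    obtain ⟨_, et, et', -⟩ := iht
    -- The premises relating sources and targets of the two ends turn into equality of those of the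
    -- values, so the values are parallel and the contraction of `G` applies.
    have ps : G.src v = G.src v' := Option.some.inj
      ((OExpr.val_src ex).symm.trans (es.trans (es'.symm.trans (OExpr.val_src ex'))))
    have pt : G.tgt v = G.tgt v' := Option.some.inj
      ((OExpr.val_tgt ex).symm.trans (et.trans (et'.symm.trans (OExpr.val_tgt ex'))))
    have A : G.Admissible v v' _ := ⟨⟨ps, pt⟩, s, s'⟩
    exact ⟨_, OExpr.val_contr ex ex' A, OExpr.val_contr ey ey' A, G.contraction.shape_cell _ _ _ A⟩
  | src_contr _ ih =>
    obtain ⟨c, ec, -, s⟩ := ih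
    -- The contraction cell has a value by induction, hence so do its ends, and its source is the
    -- value of the first of them.
    obtain ⟨v, v', A, ex, -, rfl⟩ := OExpr.val_contr_eq_some ec
    refine ⟨_, OExpr.val_src ec, ?_, (G.shape.map_src _).trans (congrArg FreeCell.src s)⟩
    rw [G.contraction.src_cell]
    exact ex
  | tgt_contr _ ih =>
    obtain ⟨c, ec, -, s⟩ := ih
    obtain ⟨v, v', A, -, ex', rfl⟩ := OExpr.val_contr_eq_some ec
    refine ⟨_, OExpr.val_tgt ec, ?_,
      (G.shape.map_tgt _).trans ((congrArg FreeCell.tgt s).trans (one_src_eq_tgt _).symm)⟩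
    rw [G.contraction.tgt_cell]
    exact ex'
  | comp_congr γ f f' _ _ _ ha ha' _ ihf ihs iht ihΛ =>
    obtain ⟨φ, E, E', S⟩ := OExpr.exists_labelling ihf ihs iht
    obtain ⟨w, eΛ, eΛ', s⟩ := ihΛ
    exact ⟨_, OExpr.val_comp φ E ha eΛ s.symm, OExpr.val_comp φ E' ha' eΛ' s.symm,
      (G.comp.map_shape _).trans (shape_labelled φ S s.symm)⟩
  | @src_comp Z γ f _ _ _ k h p a b ha hb Λ _ ihf ihs iht ihΛ =>
    obtain ⟨φ, E, -, S⟩ := OExpr.exists_labelling ihf ihs iht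
    obtain ⟨w, eΛ, -, s⟩ := ihΛ
    have s' : (freeMap (bang Z)).app p.src = G.shape.app (G.src w) :=
      ((freeMap (bang Z)).map_src p).trans
        ((congrArg FreeCell.src s.symm).trans (G.shape.map_src w).symm)
    refine ⟨_, ?_, OExpr.val_comp φ E hb (OExpr.val_src eΛ) s',
      (G.comp.map_shape _).trans (shape_labelled φ S s')⟩
    rw [G.comp_labelled_src φ s.symm s']
    exact OExpr.val_src (OExpr.val_comp φ E ha eΛ s.symm)
  | @tgt_comp Z γ f _ _ _ k h p a b ha hb Λ _ ihf ihs iht ihΛ =>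
    obtain ⟨φ, E, -, S⟩ := OExpr.exists_labelling ihf ihs iht
    obtain ⟨w, eΛ, -, s⟩ := ihΛ
    have s' : (freeMap (bang Z)).app p.tgt = G.shape.app (G.tgt w) :=
      ((freeMap (bang Z)).map_tgt p).trans
        ((congrArg FreeCell.tgt s.symm).trans (G.shape.map_tgt w).symm)
    refine ⟨_, ?_, OExpr.val_comp φ E hb (OExpr.val_tgt eΛ) s',
      (G.comp.map_shape _).trans (shape_labelled φ S s')⟩
    rw [G.comp_labelled_tgt φ s.symm s']
    exact OExpr.val_tgt (OExpr.val_comp φ E ha eΛ s.symm)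
  | ids_comp ha _ ih =>
    obtain ⟨w, eΛ, -, rfl⟩ := ih
    refine ⟨w, ?_, eΛ, rfl⟩
    -- The labelled diagram lives in `1`: it is the shape of `w`, labelled by the identity cells of
    -- `G`, as in the left unit axiom.
    refine (OExpr.val_comp G.ids.toGMap OExpr.val_ident ha eΛ
      (freeMap_id (G.shape.app w))).trans (congrArg some ?_)
    exact G.ids_comp w
  | @comp_ids k h τ Λ _ ih =>
    obtain ⟨w, eΛ, -, rfl⟩ := ih
    refine ⟨w, ?_, eΛ, rfl⟩
    have e := (freeMap_gen (bang G.toGSet) w).trans (G.ids.map_shape (h := h) PUnit.unit).symm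
    -- Here the pasting expression is a bare label and not a relabelled expression over a globular
    -- set, so the value is computed by unfolding.
    have e1 : (OExpr.comp (.gen Λ) .ident).val G =
        some (G.comp.app ⟨(FreeCell.gen w, G.ids.app PUnit.unit), e⟩) := by
      rw [OExpr.val, OExpr.pastingVal, OExpr.val, eΛ]
      exact dif_pos e
    refine e1.trans (congrArg some (Eq.trans (congrArg G.comp.app ?_) (G.comp_ids w)))
    exact Subtype.ext (Prod.ext (freeMap_id _).symm rfl)
  | @assoc Y Z γ f _ _ _ δ g _ _ _ q hq b hb k h p a c ha hc Λ _ ihf ihs iht ihg ihs' iht' ihΛ =>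
    obtain ⟨φ, E, -, S⟩ := OExpr.exists_labelling ihf ihs iht
    obtain ⟨ψ, E', -, S'⟩ := OExpr.exists_labelling ihg ihs' iht'
    obtain ⟨w, eΛ, -, s⟩ := ihΛ
    have hq' : ∀ {j : ℕ} {hj : j ≤ n} (z : Z.cell j hj),
      (freeMap (bang Y)).app (q.app z) = G.shape.app (ψ.app z) :=
        fun z => (hq z).trans (S' z).symm
    -- The flattened diagram has the shape of the inner composite: by naturality of `μ`, forgetting
    -- the labels in `Y` commutes with flattening, and `hq` identifies the shapes of the pieces with
    -- `δ`.
    have e' : (freeMap (bang Y)).app ((multMap Y).app ((freeMap q).app p)) =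
        G.shape.app (G.comp.app (labelled ψ p w s.symm)) := by
      refine (multMap_natural _ _).trans (Eq.trans ?_ (G.comp.map_shape _).symm)
      refine Eq.trans ?_ (shape_labelled ψ S' s.symm).symm
      refine congrArg (multMap (one n)).app ((freeMap_freeMap _ _ p).trans ?_)
      exact congrArg (fun χ => (freeMap χ).app p)
        (show (freeMap (bang Y)).comp q = δ from GMap.ext fun _ _ z => hq z)
    refine ⟨_, ?_, OExpr.val_comp φ E hc (OExpr.val_comp ψ E' ha eΛ s.symm) e',
      (G.comp.map_shape _).trans (shape_labelled φ S e')⟩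
    -- After this rewriting the outer labels are composites in `G`, which are the values of the
    -- label expressions on the left.
    rw [← G.comp_labelled_assoc φ ψ q hq' s.symm e']
    exact OExpr.val_comp (G.comp.toGMap.comp (labelledMap φ q ψ hq'))
      (fun z => OExpr.val_comp φ E (hb z) (E' z) (hq' z)) ha eΛ s.symm
  | top_zero hn _ _ ih ih' =>
    obtain ⟨v, e, -, s⟩ := ih
    obtain ⟨v', e', -, s'⟩ := ih'
    -- The rules for the top dimension hold because parallel `n`-cells of `G` of the same shape are
    -- equal.
    obtain rfl : v = v' := G.topUnique.eq_of_parallel hn trivial (s.trans s'.symm)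
    exact ⟨v, e, e', s⟩
  | top_succ hn _ _ _ _ ih ih' ihs iht =>
    obtain ⟨v, e, -, s⟩ := ih
    obtain ⟨v', e', -, s'⟩ := ih'
    obtain ⟨_, es, es', -⟩ := ihs
    obtain ⟨_, et, et', -⟩ := iht
    have ps : G.src v = G.src v' := Option.some.inj
      ((OExpr.val_src e).symm.trans (es.trans (es'.symm.trans (OExpr.val_src e'))))
    have pt : G.tgt v = G.tgt v' := Option.some.inj
      ((OExpr.val_tgt e).symm.trans (et.trans (et'.symm.trans (OExpr.val_tgt e'))))
    obtain rfl : v = v' := G.topUnique.eq_of_parallel hn ⟨ps, pt⟩ (s.trans s'.symm)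
    exact ⟨v, e, e', s⟩

-- The morphism out of the term model

/-- The value of a cell of `I_n` in an operad with contraction. -/
noncomputable def InitCell.val (G : CGOp.{u} n) {k : ℕ} {h : k ≤ n} (x : InitCell.{u} k h) :
    G.cell k h := (x.rep_rel.sameVal (G := G)).choose

theorem InitCell.val_rep {k : ℕ} {h : k ≤ n} (x : InitCell.{u} k h) :
    x.rep.val G = some (x.val G) := (x.rep_rel.sameVal (G := G)).choose_spec.1

theorem InitCell.shape_val {k : ℕ} {h : k ≤ n} (x : InitCell.{u} k h) :
    G.shape.app (x.val G) = x.1 := (x.rep_rel.sameVal (G := G)).choose_spec.2.2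

/-- The chosen representative is related to `a`, so by soundness any expression for a cell computes
its value. -/
theorem InitCell.val_mk {k : ℕ} {h : k ≤ n} {τ : FreeCell (one.{u} n) k h} {a : OExpr.{u} n k h}
    (H : OExpr.Rel τ a a) {v : G.cell k h} (e : a.val G = some v) :
    (InitCell.mk H).val G = v := by
  obtain ⟨w, e', e'', -⟩ := (InitCell.rel_rep H).sameVal (G := G)
  exact Option.some.inj ((InitCell.val_rep _).symm.trans (e'.trans (e''.symm.trans e)))

/-- The morphism from `I_n` to an operad with contraction. -/
noncomputable def initDesc (G : CGOp.{u} n) : CGOpHom (initialCGOp.{u} n) G where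
  app x := InitCell.val G x
  map_src x := InitCell.val_mk _ (OExpr.val_src (InitCell.val_rep x))
  map_tgt x := InitCell.val_mk _ (OExpr.val_tgt (InitCell.val_rep x))
  map_shape x := InitCell.shape_val x
  map_ids x := InitCell.val_mk _ (OExpr.val_ident x)
  -- Composition in `I_n` is defined by an expression over the cells of `I_n`, each labelled by its
  -- representative. So `Z` is `I_n` itself and the labelling in `G` is the map under construction.
  map_comp x := InitCell.val_mk _ (OExpr.val_comp (Z := (initColl n).toGSet)
    ⟨fun x => InitCell.val G x,
      fun x => InitCell.val_mk _ (OExpr.val_src (InitCell.val_rep x)),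
      fun x => InitCell.val_mk _ (OExpr.val_tgt (InitCell.val_rep x))⟩
    (fun z => InitCell.val_rep z) (exists_denotes x.1.1).choose_spec (InitCell.val_rep x.1.2)
    (x.2.trans (InitCell.shape_val x.1.2).symm))
  map_contraction x x' _ _ := InitCell.val_mk _
    (OExpr.val_contr (InitCell.val_rep x) (InitCell.val_rep x') _)

/-! ### Uniqueness -/

/-- The morphisms `F` and `F'` agree on the cell of `I_n` of shape `τ` denoted by `a`. -/
def Agree (F F' : CGOpHom (initialCGOp.{u} n) G) {k : ℕ} {h : k ≤ n}
    (τ : FreeCell (one.{u} n) k h) (a : OExpr.{u} n k h) : Prop :=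
  ∀ H : OExpr.Rel τ a a, F.app (InitCell.mk H) = F'.app (InitCell.mk H)

variable {F F' : CGOpHom (initialCGOp.{u} n) G}

/-- Related expressions denote the same cell. This lets each rule be settled on whichever of its two
sides is easier to reach. -/
theorem Agree.congr {k : ℕ} {h : k ≤ n} {τ : FreeCell (one.{u} n) k h} {a b : OExpr.{u} n k h}
    (A : Agree F F' τ a) (R : OExpr.Rel τ a b) : Agree F F' τ b := fun H => by
  rw [← InitCell.mk_eq (Ha := R.left) (Hb := H) rfl R]
  exact A R.left

theorem Agree.src {k : ℕ} {h : k + 1 ≤ n} {τ : FreeCell (one.{u} n) (k + 1) h}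
    {a : OExpr.{u} n (k + 1) h} (A : Agree F F' τ a) (H : OExpr.Rel τ a a) :
    Agree F F' τ.src a.src := fun _ =>
  (congrArg F.app (InitCell.src_mk H).symm).trans ((F.map_src (InitCell.mk H)).trans
    ((congrArg G.src (A H)).trans ((F'.map_src (InitCell.mk H)).symm.trans
      (congrArg F'.app (InitCell.src_mk H)))))

theorem Agree.tgt {k : ℕ} {h : k + 1 ≤ n} {τ : FreeCell (one.{u} n) (k + 1) h}
    {a : OExpr.{u} n (k + 1) h} (A : Agree F F' τ a) (H : OExpr.Rel τ a a) :
    Agree F F' τ.tgt a.tgt := fun _ =>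
  (congrArg F.app (InitCell.tgt_mk H).symm).trans ((F.map_tgt (InitCell.mk H)).trans
    ((congrArg G.tgt (A H)).trans ((F'.map_tgt (InitCell.mk H)).symm.trans
      (congrArg F'.app (InitCell.tgt_mk H)))))

theorem agree_ident {k : ℕ} {h : k ≤ n} :
    Agree F F' (FreeCell.gen (X := one n) PUnit.unit) (.ident : OExpr.{u} n k h) := fun _ =>
  (F.map_ids PUnit.unit).trans (F'.map_ids PUnit.unit).symm

/-- The canonical contraction is written with chosen representatives of the ends; `R` replaces these
by `x` and `x'`. Both morphisms send the contraction cell to the contraction of `G` at the images of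
its ends, which coincide. -/
theorem Agree.contr {k : ℕ} {h : k + 1 ≤ n} {τ : FreeCell (one.{u} n) (k + 1) h}
    {x x' : OExpr.{u} n k (Nat.le_of_succ_le h)} (A : Agree F F' (bdry τ) x)
    (A' : Agree F F' (bdry τ) x') (H : OExpr.Rel (bdry τ) x x) (H' : OExpr.Rel (bdry τ) x' x')
    (P : (initColl n).Parallel (InitCell.mk H) (InitCell.mk H'))
    (R : OExpr.Rel τ (.contr (InitCell.mk H).rep (InitCell.mk H').rep τ) (.contr x x' τ)) :
    Agree F F' τ (.contr x x' τ) := by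
  have D : (initColl n).Admissible (InitCell.mk H) (InitCell.mk H') τ := ⟨P, rfl, rfl⟩
  refine Agree.congr (fun K => ?_) R
  refine (F.map_contraction _ _ τ D).trans (Eq.trans ?_ (F'.map_contraction _ _ τ D).symm)
  congr 1
  · exact A H
  · exact A' H'

/-- A formal composite denotes a value of the multiplication of `I_n`, so its image is determined by
the images of the labels and of `Λ`. -/
theorem Agree.comp {Z : GSet.{u} n} (γ : GMap Z (freeGSet (one.{u} n)))
    (f : ∀ {j : ℕ} {hj : j ≤ n}, Z.cell j hj → OExpr.{u} n j hj)
    (hf : ∀ {j : ℕ} {hj : j ≤ n} (z : Z.cell j hj), OExpr.Rel (γ.app z) (f z) (f z))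
    (hs : ∀ {j : ℕ} {hj : j + 1 ≤ n} (z : Z.cell (j + 1) hj),
      OExpr.Rel (γ.app (Z.src z)) (f (Z.src z)) (f z).src)
    (ht : ∀ {j : ℕ} {hj : j + 1 ≤ n} (z : Z.cell (j + 1) hj),
      OExpr.Rel (γ.app (Z.tgt z)) (f (Z.tgt z)) (f z).tgt)
    (Af : ∀ {j : ℕ} {hj : j ≤ n} (z : Z.cell j hj), Agree F F' (γ.app z) (f z))
    {k : ℕ} {h : k ≤ n} {p : FreeCell Z k h} {a : PExpr Z.cell k h} (ha : a.Denotes Z p)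
    {Λ : OExpr n k h} (hΛ : OExpr.Rel ((freeMap (bang Z)).app p) Λ Λ)
    (AΛ : Agree F F' ((freeMap (bang Z)).app p) Λ) :
    Agree F F' ((multMap (one n)).app ((freeMap γ).app p)) (.comp (a.map f) Λ) := fun H => by
  -- The classes of the labels form a map of globular sets by `hs` and `ht`.
  let φ : GMap Z (initColl.{u} n).toGSet :=
    { app := fun z => InitCell.mk (hf z)
      map_src := fun z => (InitCell.mk_eq (γ.map_src z) (hs z)).trans (InitCell.src_mk (hf z)).symm
      map_tgt := fun z => (InitCell.mk_eq (γ.map_tgt z) (ht z)).trans (InitCell.tgt_mk (hf z)).symm }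
  have R := compRep_labels (labelled (G := initColl n) φ p (InitCell.mk hΛ) rfl) φ rfl f
    (fun z => InitCell.rel_rep (hf z)) ha (InitCell.rel_rep hΛ)
  -- The operation of `I_n`, computed with chosen representatives, gives the class of the formal
  -- composite written with `f`, `a` and `Λ`.
  have e : (initComp n).app (labelled (G := initColl n) φ p (InitCell.mk hΛ) rfl) =
      InitCell.mk H :=
    InitCell.mk_eq (shape_labelled (G := initColl n) φ (γ := γ) (fun _ => rfl) rfl) R
  rw [← e]
  refine (F.map_comp _).trans (Eq.trans (congrArg G.comp.app ?_) (F'.map_comp _).symm)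
  refine (tensorMap_labelled F.toCollHom φ _).trans
    (Eq.trans ?_ (tensorMap_labelled F'.toCollHom φ _).symm)
  exact labelled_congr (fun z => Af z (hf z)) (AΛ hΛ) _

/-- Only the left expression of each relation is tracked; `Agree.congr` transports agreement to the
right one, which handles `symm`. A derivation, unlike the bare expression, provides well-formed
constituents with their shapes. -/
theorem OExpr.Rel.agree {k : ℕ} {h : k ≤ n} {τ : FreeCell (one.{u} n) k h}
    {a b : OExpr.{u} n k h} (H : OExpr.Rel τ a b) : Agree F F' τ a := by
  induction H with
  | symm H ih => exact ih.congr H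
  | trans _ _ ih _ => exact ih
  | src_congr H ih => exact ih.src H.left
  | tgt_congr H ih => exact ih.tgt H.left
  | src_src H ih => exact (ih.src H).src H.src_congr
  | tgt_tgt H ih =>
    -- The relation is indexed by `τ.tgt.tgt`, the shape reached by taking targets twice, so the
    -- right side `a.tgt.tgt` is used.
    refine Agree.congr ?_ H.tgt_tgt.symm
    exact (ih.tgt H).tgt H.tgt_congr
  | ident => exact agree_ident
  | src_ident => exact agree_ident.congr (.symm .src_ident)
  | tgt_ident => exact agree_ident.congr (.symm .tgt_ident)
  | contr_zero H H' ih ih' =>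
    exact ih.contr ih' H.left H'.left trivial
      (.contr_zero (InitCell.rel_rep H.left) (InitCell.rel_rep H'.left))
  | contr_succ H H' Hs Ht ih ih' _ _ =>
    have P := And.intro
      ((InitCell.src_mk H.left).trans ((InitCell.mk_eq rfl Hs).trans (InitCell.src_mk H'.left).symm))
      ((InitCell.tgt_mk H.left).trans ((InitCell.mk_eq rfl (one_src_eq_tgt (bdry _) ▸ Ht)).trans
        (InitCell.tgt_mk H'.left).symm))
    refine ih.contr ih' H.left H'.left P ?_
    have K := InitCell.rel_rep H.left
    have K' := InitCell.rel_rep H'.left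
    refine .contr_succ K K' (K.src_congr.trans (Hs.trans K'.src_congr.symm)) ?_
    have Kt := K.tgt_congr
    have Kt' := K'.tgt_congr
    -- Targets arrive with shape `(bdry τ).tgt`, whereas the rule expects `bdry (bdry τ)`; these
    -- agree for pasting diagrams in `1`.
    rw [← one_src_eq_tgt] at Kt Kt'
    exact Kt.trans (Ht.trans Kt'.symm)
  | src_contr H ih => exact ih.src H
  | tgt_contr H ih =>
    have A := ih.tgt H
    rw [← one_src_eq_tgt] at A
    exact A
  | comp_congr γ f f' hf hs ht ha ha' hΛ ihf _ _ ihΛ =>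
    exact Agree.comp γ f (fun z => (hf z).left) hs ht ihf ha hΛ.left ihΛ
  | @src_comp Z γ f hf hs ht k h p a b ha hb Λ hΛ ihf _ _ ihΛ =>
    -- The shape of the composite along `p.src` is the source of the shape of the whole composite,
    -- so agreement on the whole composite passes to its source.
    have e : (multMap (one n)).app ((freeMap γ).app p.src) =
      FreeCell.src ((multMap (one n)).app ((freeMap γ).app p)) :=
        ((multMap (one n)).comp (freeMap γ)).map_src p
    rw [e]
    exact (Agree.comp γ f hf hs ht ihf ha hΛ ihΛ).src (.comp_congr γ f f hf hs ht ha ha hΛ)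
  | @tgt_comp Z γ f hf hs ht k h p a b ha hb Λ hΛ ihf _ _ ihΛ =>
    have e : (multMap (one n)).app ((freeMap γ).app p.tgt) =
      FreeCell.tgt ((multMap (one n)).app ((freeMap γ).app p)) :=
        ((multMap (one n)).comp (freeMap γ)).map_tgt p
    rw [e]
    exact (Agree.comp γ f hf hs ht ihf ha hΛ ihΛ).tgt (.comp_congr γ f f hf hs ht ha ha hΛ)
  | ids_comp ha hΛ ih => exact ih.congr (OExpr.Rel.ids_comp ha hΛ).symm
  | comp_ids hΛ ih => exact ih.congr (OExpr.Rel.comp_ids hΛ).symm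
  | @assoc Y Z γ f hf hs ht δ g hg hs' ht' q hq b hb k h p a c ha hc Λ hΛ ihf _ _ ihg _ _ ihΛ =>
    have e : (multMap (one n)).app ((freeMap δ).app p) =
        (freeMap (bang Y)).app ((multMap Y).app ((freeMap q).app p)) := by
      refine Eq.symm ((multMap_natural _ _).trans ?_)
      refine congrArg (multMap (one n)).app ((freeMap_freeMap _ _ p).trans ?_)
      exact congrArg (fun χ => (freeMap χ).app p)
        (show (freeMap (bang Y)).comp q = δ from GMap.ext fun _ _ z => hq z)
    -- The right side is a composite of a composite whose labellings `f` and `g` are covered by the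
    -- hypotheses; on the left, the composite labels would first have to be shown compatible with
    -- sources and targets.
    refine Agree.congr ?_ (OExpr.Rel.assoc γ f hf hs ht δ g hg hs' ht' q hq b hb ha hc hΛ).symm
    exact Agree.comp γ f hf hs ht ihf hc (e ▸ .comp_congr δ g g hg hs' ht' ha ha hΛ)
      (e ▸ Agree.comp δ g hg hs' ht' ihg ha hΛ ihΛ)
  | top_zero _ _ _ ih _ => exact ih
  | top_succ _ _ _ _ _ ih _ _ _ => exact ih

theorem initialCGOp_hom_unique (F F' : CGOpHom (initialCGOp.{u} n) G) : F = F' :=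
  CGOpHom.ext fun _ _ x => (congrArg F.app (InitCell.mk_rep x).symm).trans
    ((x.rep_rel.agree x.rep_rel).trans (congrArg F'.app (InitCell.mk_rep x)))

end Glob

theorem mainTheorem3 (n : ℕ) :
    Nonempty (CategoryTheory.Limits.IsInitial (Glob.initialCGOp.{u} n)) :=
  ⟨CategoryTheory.Limits.IsInitial.ofUniqueHom (fun G => Glob.initDesc G)
    fun _ F => Glob.initialCGOp_hom_unique F _⟩
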